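/- Let $R$ be an associative ring with unity; modules are left $R$-modules and complexes are unbounded complexes of left $R$-modules, graded homologically, with differentials $\delta^X_i : X_i \to X_{i-1}$. Put $\mathrm{C}_n(X)=\operatorname{Coker}(\delta^X_{n+1})$ and $\sup X=\sup\{i\in\mathbb{Z} : \mathrm{H}_i(X)\neq 0\}$ (so $\sup X=-\infty$ if $X$ is exact). Let $\mathcal{F}$ be the class of flat modules. A complex $T$ is totally $\mathcal{F}$-acyclic if every $T_i$ is projective, $T$ is exact, and $\operatorname{Hom}_R(T,F)$ is exact for every $F\in\mathcal{F}$. A module $M$ is Ding projective if $M\cong \mathrm{C}_0(T)$ for some totally $\mathcal{F}$-acyclic complex $T$. A complex $P$ is DG-projective if every $P_i$ is projective and the complex $\operatorname{Hom}_R(P,Y)$ is exact for every exact complex $Y$. A DG-projective resolution of $X$ is a quasi-isomorphism $\pi:P\to X$ with $P$ DG-projective. An $\mathcal{F}$-complete resolution of $X$ is a diagram of morphisms of complexes $T\xrightarrow{\tau}P\xrightarrow{\pi}X$ in which $\pi$ is a DG-projective resolution of $X$, $T$ is totally $\mathcal{F}$-acyclic, and $\tau_i$ is bijective for all $i\gg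 0$; it is surjective if $\tau_i$ is surjective for all $i\in\mathbb{Z}$. The Ding projective dimension $\operatorname{Dpd}_R(X)\in\{-\infty\}\cup\mathbb{Z}\cup\{\infty\}$ is the infimum of the integers $n$ for which there is an $\mathcal{F}$-complete resolution $T\xrightarrow{\tau}P\xrightarrow{\pi}X$ with $\tau_i$ bijective for each $i\geq n$. **Theorem.** Let $X$ be a complex and $n$ an integer. The following assertions are equivalent: 1. $\operatorname{Dpd}_R(X)\leq n$. 2. $\sup X\leq n$ and there exists a DG-projective resolution $P\to X$ such that the module $\mathrm{C}_n(P)$ is Ding projective. 3. $\sup X\leq n$ and for every DG-projective resolution $P'\to X$ the module $\mathrm{C}_n(P')$ is Ding projective. 4. For every DG-projective resolution $\pi':P'\to X$ there exists a surjective $\mathcal{F}$-complete resolution $T'\xrightarrow{\tau'}P'\xrightarrow{\pi'}X$ such that $T'_i=P'_i$ and $\tau'_i=\mathrm{id}_{T'_i}$ for all $i\geq n$. -/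

import Mathlib

open CategoryTheory CategoryTheory.Limits
open scoped TensorProduct MulOpposite

universe u

namespace DingDim

noncomputable section

/-! ### Tensor products and flatness over an arbitrary (noncommutative) ring

A right `R`-module is a module over `Rᵐᵒᵖ`; thus `MulOpposite.op r • x` is `x r`. -/

/-- The subgroup of `N ⊗_ℤ M` generated by the elements `(x r) ⊗ m - x ⊗ (r m)`. -/
def balancedRelations (R : Type u) [Ring R] (N : Type u) [AddCommGroup N] [Module Rᵐᵒᵖ N]
    (M : Type u) [AddCommGroup M] [Module R M] : AddSubgroup (N ⊗[ℤ] M) :=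
  AddSubgroup.closure
    {t | ∃ (x : N) (r : R) (m : M), t = (MulOpposite.op r • x) ⊗ₜ[ℤ] m - x ⊗ₜ[ℤ] (r • m)}

/-- The tensor product `N ⊗_R M` of a right module and a left module, an abelian group. -/
abbrev BalancedTensor (R : Type u) [Ring R] (N : Type u) [AddCommGroup N] [Module Rᵐᵒᵖ N]
    (M : Type u) [AddCommGroup M] [Module R M] : Type u :=
  (N ⊗[ℤ] M) ⧸ balancedRelations R N M

theorem balancedRelations_le_comap (R : Type u) [Ring R]
    {N N' : Type u} [AddCommGroup N] [Module Rᵐᵒᵖ N] [AddCommGroup N'] [Module Rᵐᵒᵖ N']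
    (f : N →ₗ[Rᵐᵒᵖ] N') (M : Type u) [AddCommGroup M] [Module R M] :
    balancedRelations R N M ≤ (balancedRelations R N' M).comap
      (f.toAddMonoidHom.toIntLinearMap.rTensor M).toAddMonoidHom := by
  refine (AddSubgroup.closure_le _).2 ?_
  rintro _ ⟨x, r, m, rfl⟩
  refine AddSubgroup.subset_closure ⟨f x, r, m, ?_⟩
  simp

/-- The induced map `f ⊗_R M : N ⊗_R M → N' ⊗_R M`, `x ⊗ m ↦ f x ⊗ m`. -/
def BalancedTensor.map (R : Type u) [Ring R]
    {N N' : Type u} [AddCommGroup N] [Module Rᵐᵒᵖ N] [AddCommGroup N'] [Module Rᵐᵒᵖ N']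
    (f : N →ₗ[Rᵐᵒᵖ] N') (M : Type u) [AddCommGroup M] [Module R M] :
    BalancedTensor R N M →+ BalancedTensor R N' M :=
  QuotientAddGroup.map _ _ (f.toAddMonoidHom.toIntLinearMap.rTensor M).toAddMonoidHom
    (balancedRelations_le_comap R f M)

/-- A left `R`-module `M` is flat if `- ⊗_R M` preserves injectivity of maps of right
`R`-modules. -/
def IsFlat (R : Type u) [Ring R] (M : Type u) [AddCommGroup M] [Module R M] : Prop :=
  ∀ (N N' : Type u) [AddCommGroup N] [Module Rᵐᵒᵖ N] [AddCommGroup N'] [Module Rᵐᵒᵖ N']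
    (f : N →ₗ[Rᵐᵒᵖ] N'), Function.Injective f → Function.Injective (BalancedTensor.map R f M)

/-! ### Complexes of left `R`-modules

Complexes are unbounded and graded homologically: the differential of `X` is
`X.d (n + 1) n : X.X (n + 1) ⟶ X.X n`. -/

/-- Complexes of left `R`-modules. -/
abbrev Cplx (R : Type u) [Ring R] : Type (u + 1) := ChainComplex (ModuleCat.{u} R) ℤ

variable {R : Type u} [Ring R]

/-- `C_n(X)`, the cokernel of `X_{n+1} → X_n`. -/
abbrev coker (X : Cplx R) (n : ℤ) : ModuleCat.{u} R := cokernel (X.d (n + 1) n)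

/-- The supremum of the degrees with nonzero homology: `⊥` if `X` is exact. -/
def supH (X : Cplx R) : WithBot (WithTop ℤ) :=
  sSup {a | ∃ i : ℤ, ¬ IsZero (X.homology i) ∧ a = ((i : WithTop ℤ) : WithBot (WithTop ℤ))}

/-- `T` is totally `F`-acyclic, for `F` the class of flat modules: an exact complex of projective
modules such that the complex of abelian groups `Hom_R(T, F)` is exact for every flat `F`. -/
structure IsTotallyFAcyclic (T : Cplx R) : Prop where
  projective : ∀ n, Module.Projective R (T.X n)
  exact : T.Acyclic
  hom_exact : ∀ F : ModuleCat.{u} R, IsFlat R F → ∀ n : ℤ,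
    Function.Exact (fun g : T.X (n - 1) ⟶ F => T.d n (n - 1) ≫ g)
      (fun g : T.X n ⟶ F => T.d (n + 1) n ≫ g)

/-- A module is Ding projective if it is `C_0(T)` for a totally `F`-acyclic complex `T`. -/
def IsDingProjective (M : ModuleCat.{u} R) : Prop :=
  ∃ T : Cplx R, IsTotallyFAcyclic T ∧ Nonempty (coker T 0 ≅ M)

/-- The degree `n` part of the Hom complex `Hom_R(P, Y)`: families of homomorphisms
`P_i → Y_{i+n}` for `i ∈ ℤ`, written as families indexed by the pairs `(i, j)` with
`i + n = j`. -/
abbrev HomDeg (P Y : Cplx R) (n : ℤ) : Type u :=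
  ∀ p : {p : ℤ × ℤ // p.1 + n = p.2}, P.X p.1.1 ⟶ Y.X p.1.2

/-- The differential of the Hom complex, from degree `n` to degree `m = n - 1`:
`f ↦ d f - (-1)^n f d`. -/
def homDiff (P Y : Cplx R) (n m : ℤ) (h : m + 1 = n) (f : HomDeg P Y n) : HomDeg P Y m :=
  fun p =>
    f ⟨(p.1.1, p.1.2 + 1), by have := p.2; dsimp only; omega⟩ ≫ Y.d (p.1.2 + 1) p.1.2
      - n.negOnePow •
        (P.d p.1.1 (p.1.1 - 1) ≫ f ⟨(p.1.1 - 1, p.1.2), by have := p.2; dsimp only; omega⟩)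

/-- A complex `P` is DG-projective if it consists of projective modules and the complex
`Hom_R(P, Y)` is exact for every exact complex `Y`. -/
structure IsDGProjective (P : Cplx R) : Prop where
  projective : ∀ n, Module.Projective R (P.X n)
  hom_exact : ∀ Y : Cplx R, Y.Acyclic → ∀ n : ℤ,
    Function.Exact (homDiff P Y (n + 1) n rfl) (homDiff P Y n (n - 1) (by omega))

/-- `π : P ⟶ X` is a DG-projective resolution of `X`. -/
structure IsDGProjectiveResolution {P X : Cplx R} (π : P ⟶ X) : Prop where
  dgProjective : IsDGProjective P
  quasiIso : QuasiIso π

/-- `T --τ--> P --π--> X` is an `F`-complete resolution of `X`. -/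
structure IsFCompleteResolution {T P X : Cplx R} (τ : T ⟶ P) (π : P ⟶ X) : Prop where
  resolution : IsDGProjectiveResolution π
  totallyFAcyclic : IsTotallyFAcyclic T
  eventually_bijective : ∃ g : ℤ, ∀ i, g ≤ i → Function.Bijective (τ.f i)

/-- A surjective `F`-complete resolution: all components of `τ` are surjective. -/
structure IsSurjectiveFCompleteResolution {T P X : Cplx R} (τ : T ⟶ P) (π : P ⟶ X) : Prop
    extends IsFCompleteResolution τ π where
  surjective : ∀ i, Function.Surjective (τ.f i)

/-- The Ding projective dimension of `X`: the infimum, in `{-∞} ∪ ℤ ∪ {∞}`, of the integers `n`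
such that there is an `F`-complete resolution of `X` with `τ_i` bijective for all `i ≥ n`. -/
def Dpd (X : Cplx R) : WithBot (WithTop ℤ) :=
  sInf {a | ∃ n : ℤ, a = ((n : WithTop ℤ) : WithBot (WithTop ℤ)) ∧
    ∃ (T P : Cplx R) (τ : T ⟶ P) (π : P ⟶ X),
      IsFCompleteResolution τ π ∧ ∀ i, n ≤ i → Function.Bijective (τ.f i)}

end

end DingDim

/-! The theorem rests on one principle, `IsTotallyFAcyclic.exists_of_contraction`. Let a totally
acyclic complex `E` map onto a complex `P` of projectives, and suppose that the kernel is
contractible in degrees `≥ n`. From the contraction one builds an idempotent `ds + sd` of `E` with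
values in the kernel, equal to the identity on the kernel in degrees `≥ n`. The complementary
summand is totally acyclic, as a retract of `E`, and maps onto `P`, bijectively in degrees `≥ n`.
Surjectivity is arranged by adding to the source the contractible complex on the target (`padded`,
`padDesc`), which does not affect total acyclicity.

For (1) ⇒ (4), compare two DG-projective resolutions by a quasi-isomorphism `f : P ⟶ P'`. The
surjection of `P`, padded, onto `P'` then splits up to a homotopy inside its kernel. Since `T ⟶ P`
is bijective in degrees `≥ n`, that homotopy pulls back to the padding of `T` in those degrees, and
the principle applies. Transporting module structures along the bijections turns them into
identities.

For (2) ⇒ (1), an isomorphism `C_n(T) ≅ C_n(P)` lifts to `T_n → P_n`. It extends upwards because `P`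
is exact above `n` and `T` is projective, and downwards because each `P_i` is projective, hence
flat, so that `Hom(T, P_i)` is exact. The inverse isomorphism supplies the first component, in
degree `n - 1`, of a contraction of the kernel of the padded map; the remaining components are
constructed by induction.

For (4) ⇒ (3) and (3) ⇒ (2), exactness above `n` and the cokernel `C_n` are read off from `T`. Some
DG-projective resolution must exist; it comes from the small object argument for the inclusions of
spheres into disks. -/

namespace DingDim

/-! ### Elementwise exactness, quasi-isomorphisms and kernels -/

section Elements

variable {R : Type u} [Ring R]

/-- Elementwise exactness of a sequence `X_i → X_j → X_k` of a complex. -/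
def ExactElt (X : Cplx R) (i j k : ℤ) : Prop :=
  ∀ x : X.X j, X.d j k x = 0 → ∃ y : X.X i, X.d i j y = x

theorem d_d_apply (X : Cplx R) (i j k : ℤ) (x : X.X i) : X.d j k (X.d i j x) = 0 := by
  rw [← ConcreteCategory.comp_apply, X.d_comp_d]; rfl

theorem f_d_apply {X Y : Cplx R} (f : X ⟶ Y) (i j : ℤ) (x : X.X i) :
    f.f j (X.d i j x) = Y.d i j (f.f i x) := by
  rw [← ConcreteCategory.comp_apply, ← f.comm, ConcreteCategory.comp_apply]

theorem exactAt_iff_exactElt (X : Cplx R) (i j k : ℤ) (hij : j + 1 = i) (hjk : k + 1 = j) :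
    X.ExactAt j ↔ ExactElt X i j k := by
  rw [X.exactAt_iff' i j k (by simp [hij]) (by simp; omega), ShortComplex.moduleCat_exact_iff]
  rfl

theorem acyclic_iff_exactElt (X : Cplx R) :
    X.Acyclic ↔ ∀ i j k : ℤ, j + 1 = i → k + 1 = j → ExactElt X i j k := by
  refine ⟨fun h i j k hij hjk => (exactAt_iff_exactElt X i j k hij hjk).1 (h j), fun h j => ?_⟩
  exact (exactAt_iff_exactElt X (j + 1) j (j - 1) rfl (by omega)).2 (h _ _ _ rfl (by omega))

/-- Elementwise form of the bijectivity of a chain map in homology of degree `j`. -/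
def QisoElt {X Y : Cplx R} (f : X ⟶ Y) (i j k : ℤ) : Prop :=
  (∀ x : X.X j, X.d j k x = 0 → (∃ y : Y.X i, Y.d i j y = f.f j x) →
    ∃ z : X.X i, X.d i j z = x) ∧
  (∀ y : Y.X j, Y.d j k y = 0 → ∃ x : X.X j, X.d j k x = 0 ∧
    ∃ w : Y.X i, y = f.f j x + Y.d i j w)

/-- The map from the free module on a set given by the values on the basis. -/
noncomputable def fromFree {S : Type u} {M : ModuleCat.{u} R} (v : S → M) :
    ModuleCat.of R (S →₀ R) ⟶ M :=
  ModuleCat.ofHom (Finsupp.linearCombination R v)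

/-- A basis element of a free module. -/
noncomputable def freeBasis (R : Type u) [Ring R] {S : Type u} (s : S) : ModuleCat.of R (S →₀ R) :=
  Finsupp.single s 1

theorem fromFree_single {S : Type u} {M : ModuleCat.{u} R} (v : S → M) (s : S) :
    fromFree v (freeBasis R s) = v s := by
  simp [fromFree, freeBasis]

theorem fromFree_ext {S : Type u} {M : ModuleCat.{u} R} {f g : ModuleCat.of R (S →₀ R) ⟶ M}
    (h : ∀ s, f (freeBasis R s) = g (freeBasis R s)) : f = g := by
  ext s
  exact h s

theorem epi_fromFree_id (M : ModuleCat.{u} R) : Epi (fromFree (id : M → M)) :=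
  (ModuleCat.epi_iff_surjective _).2 fun m => ⟨_, fromFree_single id m⟩

/-- The categorical criteria hold up to refinement by an epimorphism. The free module on the set `A`
covers `A` and admits maps defined by arbitrary choices of witnesses; conversely, testing on a free
module of rank one recovers single elements. -/
theorem quasiIsoAt_iff_qisoElt {X Y : Cplx R} (f : X ⟶ Y) (i j k : ℤ)
    (hij : j + 1 = i) (hjk : k + 1 = j) :
    QuasiIsoAt f j ↔ QisoElt f i j k := by
  have hi : (ComplexShape.down ℤ).prev j = i := by simp [hij]
  have hk : (ComplexShape.down ℤ).next j = k := by simp; omega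
  rw [quasiIsoAt_iff_isIso_homologyMap, isIso_iff_mono_and_epi,
    HomologicalComplex.mono_homologyMap_iff_up_to_refinements f i j k hi hk,
    HomologicalComplex.epi_homologyMap_iff_up_to_refinements f i j k hi hk]
  refine and_congr ⟨fun h x hx ⟨y, hy⟩ => ?_, fun h A x₂ hx₂ y₁ hy => ?_⟩
    ⟨fun h y hy => ?_, fun h A y₂ hy₂ => ?_⟩
  · obtain ⟨A', π, hπ, x₁, e⟩ := h (fromFree fun _ : PUnit => x)
      (fromFree_ext fun s => (congrArg (X.d j k) (fromFree_single _ s)).trans hx)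
      (fromFree fun _ => y) (fromFree_ext fun s => (congrArg (f.f j) (fromFree_single _ s)).trans
        (hy.symm.trans
          (congrArg (Y.d i j) (fromFree_single (fun _ : PUnit => y) s).symm)))
    obtain ⟨a, ha⟩ := (ModuleCat.epi_iff_surjective _).1 hπ (freeBasis R PUnit.unit)
    refine ⟨x₁ a, congr($e a).symm.trans ((congrArg _ ha).trans (fromFree_single _ _))⟩
  · have H : ∀ a : A, ∃ z : X.X i, X.d i j z = x₂ a := fun a => h _
      congr($hx₂ a) ⟨y₁ a, congr($hy a).symm⟩
    choose z hz using H
    exact ⟨_, _, epi_fromFree_id A, fromFree z, fromFree_ext fun s =>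
      (congrArg x₂ (fromFree_single _ s)).trans
        ((hz s).symm.trans (congrArg (X.d i j) (fromFree_single _ s).symm))⟩
  · obtain ⟨A', π, hπ, x₂, hx, y₁, e⟩ := h (fromFree fun _ : PUnit => y)
      (fromFree_ext fun s => (congrArg (Y.d j k) (fromFree_single _ s)).trans hy)
    obtain ⟨a, ha⟩ := (ModuleCat.epi_iff_surjective _).1 hπ (freeBasis R PUnit.unit)
    exact ⟨x₂ a, congr($hx a), y₁ a,
      (fromFree_single (fun _ => y) PUnit.unit).symm.trans ((congrArg _ ha).symm.trans congr($e a))⟩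
  · have H : ∀ a : A, _ := fun a => h (y₂ a) congr($hy₂ a)
    choose x hx w hw using H
    exact ⟨_, _, epi_fromFree_id A, fromFree x,
      fromFree_ext fun s => (congrArg (X.d j k) (fromFree_single _ s)).trans (hx s), fromFree w,
      fromFree_ext fun s => (congrArg y₂ (fromFree_single _ s)).trans ((hw s).trans (congrArg₂ _
        (congrArg (f.f j) (fromFree_single _ s).symm)
        (congrArg (Y.d i j) (fromFree_single _ s).symm)))⟩

theorem quasiIso_iff_qisoElt {X Y : Cplx R} (f : X ⟶ Y) :
    QuasiIso f ↔ ∀ i j k : ℤ, j + 1 = i → k + 1 = j → QisoElt f i j k := by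
  refine ⟨fun h i j k hij hjk => (quasiIsoAt_iff_qisoElt f i j k hij hjk).1 inferInstance,
    fun h => ⟨fun j => ?_⟩⟩
  exact (quasiIsoAt_iff_qisoElt f (j + 1) j (j - 1) rfl (by omega)).2 (h _ _ _ rfl (by omega))

/-- Elementwise exactness of the kernel of a chain map. -/
def KerExact {X Y : Cplx R} (f : X ⟶ Y) : Prop :=
  ∀ i j k : ℤ, j + 1 = i → k + 1 = j → ∀ x : X.X j, X.d j k x = 0 → f.f j x = 0 →
    ∃ y : X.X i, f.f i y = 0 ∧ X.d i j y = x

/-- A surjective chain map with exact kernel is a quasi-isomorphism. -/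
theorem quasiIso_of_kerExact {X Y : Cplx R} (f : X ⟶ Y)
    (hs : ∀ i, Function.Surjective (f.f i)) (hk : KerExact f) : QuasiIso f := by
  refine (quasiIso_iff_qisoElt f).2 fun i j k hij hjk => ⟨?_, ?_⟩
  · rintro x hx ⟨y, hy⟩
    obtain ⟨y', rfl⟩ := hs _ y
    obtain ⟨z, -, hz⟩ := hk i j k hij hjk (x - X.d i j y') (by simp [hx, d_d_apply])
      (by rw [map_sub, f_d_apply, hy, sub_self])
    exact ⟨z + y', by rw [map_add, hz]; abel⟩
  · intro y hy
    obtain ⟨x, rfl⟩ := hs _ y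
    obtain ⟨z, hz, hz'⟩ := hk j k (k - 1) hjk (by omega) (X.d j k x) (d_d_apply _ _ _ _ _)
      (by rw [f_d_apply, hy])
    exact ⟨x - z, by rw [map_sub, hz', sub_self], 0, by simp [hz]⟩

/-- The kernel of a chain map, as a complex of submodules. -/
def kerCplx {X Y : Cplx R} (f : X ⟶ Y) : Cplx R where
  X i := ModuleCat.of R (LinearMap.ker (f.f i).hom)
  d i j := ModuleCat.ofHom ((X.d i j).hom.restrict fun x hx => by
    have := f_d_apply f i j x
    rw [LinearMap.mem_ker] at hx ⊢
    rw [this, hx, map_zero])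
  shape i j h := by
    refine ModuleCat.hom_ext (LinearMap.ext fun x => ?_)
    exact Subtype.ext congr($(X.shape i j h) (x : LinearMap.ker (f.f i).hom).1)
  d_comp_d' i j k _ _ := by
    refine ModuleCat.hom_ext (LinearMap.ext fun x => ?_)
    exact Subtype.ext (d_d_apply X i j k (x : LinearMap.ker (f.f i).hom).1)

theorem kerCplx_acyclic {X Y : Cplx R} (f : X ⟶ Y) (h : KerExact f) : (kerCplx f).Acyclic := by
  rw [acyclic_iff_exactElt]
  intro i j k hij hjk x hx
  obtain ⟨y, hy, e⟩ := h i j k hij hjk x.1 congr(($hx).1) x.2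
  exact ⟨⟨y, hy⟩, Subtype.ext e⟩

/-- The inclusion of the kernel of a chain map. -/
def kerι {X Y : Cplx R} (f : X ⟶ Y) : kerCplx f ⟶ X where
  f i := ModuleCat.ofHom (LinearMap.ker (f.f i).hom).subtype
  comm' _ _ _ := rfl

end Elements

/-! ### Adding a contractible complex to make a chain map surjective -/

section Padded

variable {R : Type u} [Ring R]

/-- The differential of `padded A B`. -/
def paddedD (A B : Cplx R) (j : ℤ) :
    ModuleCat.of R (A.X (j + 1) × B.X (j + 1 + 1) × B.X (j + 1)) ⟶
      ModuleCat.of R (A.X j × B.X (j + 1) × B.X j) :=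
  ModuleCat.ofHom
    { toFun := fun p => (A.d (j + 1) j p.1, p.2.2 - B.d (j + 1 + 1) (j + 1) p.2.1,
        B.d (j + 1) j p.2.2)
      map_add' := fun p q => by
        refine Prod.ext (map_add _ _ _) (Prod.ext ?_ (map_add _ _ _))
        simp only [Prod.snd_add, Prod.fst_add, map_add]
        abel
      map_smul' := fun r p => by
        refine Prod.ext (map_smul _ _ _) (Prod.ext ?_ (map_smul _ _ _))
        simp only [Prod.smul_snd, Prod.smul_fst, map_smul, RingHom.id_apply, smul_sub] }

/-- The direct sum of `A` and the contractible complex on `B`, which in degree `i` is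
`B_{i+1} × B_i`. -/
def padded (A B : Cplx R) : Cplx R :=
  ChainComplex.of (fun i => ModuleCat.of R (A.X i × B.X (i + 1) × B.X i)) (paddedD A B)
    fun j => by
      refine ModuleCat.hom_ext (LinearMap.ext fun p => ?_)
      refine Prod.ext (d_d_apply A _ _ _ p.1) (Prod.ext ?_ (d_d_apply B _ _ _ p.2.2))
      change B.d _ _ p.2.2 - B.d _ _ (p.2.2 - B.d _ _ p.2.1) = 0
      rw [map_sub, d_d_apply]
      abel

/-- Elements of `padded A B`. -/
def padMk {A B : Cplx R} {i : ℤ} (a : A.X i) (x : B.X (i + 1)) (b : B.X i) : (padded A B).X i :=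
  (⟨a, x, b⟩ : A.X i × B.X (i + 1) × B.X i)

theorem padMk_surj {A B : Cplx R} {i : ℤ} (p : (padded A B).X i) :
    ∃ a x b, p = padMk a x b := ⟨_, _, _, rfl⟩

theorem padMk_inj {A B : Cplx R} {i : ℤ} {a a' : A.X i} {x x' : B.X (i + 1)} {b b' : B.X i} :
    (padMk a x b : (padded A B).X i) = padMk a' x' b' ↔ a = a' ∧ x = x' ∧ b = b' := by
  refine ⟨fun h => ⟨congrArg Prod.fst h, congrArg (fun p => p.2.1) h,
    congrArg (fun p => p.2.2) h⟩, ?_⟩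
  rintro ⟨rfl, rfl, rfl⟩
  rfl

theorem padMk_add {A B : Cplx R} {i : ℤ} (a a' : A.X i) (x x' : B.X (i + 1)) (b b' : B.X i) :
    (padMk a x b : (padded A B).X i) + padMk a' x' b' = padMk (a + a') (x + x') (b + b') := rfl

theorem padMk_sub {A B : Cplx R} {i : ℤ} (a a' : A.X i) (x x' : B.X (i + 1)) (b b' : B.X i) :
    (padMk a x b : (padded A B).X i) - padMk a' x' b' = padMk (a - a') (x - x') (b - b') := rfl

theorem padMk_zero {A B : Cplx R} {i : ℤ} : (0 : (padded A B).X i) = padMk 0 0 0 := rfl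

theorem padded_d {A B : Cplx R} (j : ℤ) (a : A.X (j + 1)) (x : B.X (j + 1 + 1)) (b : B.X (j + 1)) :
    (padded A B).d (j + 1) j (padMk a x b) =
      padMk (A.d (j + 1) j a) (b - B.d (j + 1 + 1) (j + 1) x) (B.d (j + 1) j b) := by
  have : (padded A B).d (j + 1) j = paddedD A B j :=
    ChainComplex.of_d (fun i => ModuleCat.of R (A.X i × B.X (i + 1) × B.X i)) (paddedD A B) j
  rw [this]
  rfl

theorem hom_ext_of_succ {X Y : Cplx R} (f : ∀ i, X.X i ⟶ Y.X i)
    (h : ∀ j x, f j (X.d (j + 1) j x) = Y.d (j + 1) j (f (j + 1) x)) (i j : ℤ)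
    (hij : (ComplexShape.down ℤ).Rel i j) : f i ≫ Y.d i j = X.d i j ≫ f j := by
  obtain rfl : j + 1 = i := hij
  exact ModuleCat.hom_ext (LinearMap.ext fun x => (h j x).symm)

/-- The inclusion of the first summand of `padded A B`. -/
def padIn (A B : Cplx R) : A ⟶ padded A B where
  f i := ModuleCat.ofHom (LinearMap.inl R (A.X i) (B.X (i + 1) × B.X i))
  comm' := hom_ext_of_succ _ fun j x => by
    change padMk _ _ _ = (padded A B).d (j + 1) j (padMk x 0 0)
    rw [padded_d, map_zero, map_zero, sub_zero]
    rfl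

theorem padIn_apply {A B : Cplx R} {i : ℤ} (a : A.X i) :
    (padIn A B).f i a = padMk a 0 0 := rfl

/-- The projection to the first summand of `padded A B`. -/
def padFst (A B : Cplx R) : padded A B ⟶ A where
  f i := ModuleCat.ofHom (LinearMap.fst R (A.X i) (B.X (i + 1) × B.X i))
  comm' := hom_ext_of_succ _ fun j p => by
    obtain ⟨a, x, b, rfl⟩ := padMk_surj p
    rw [padded_d]
    rfl

theorem padFst_apply {A B : Cplx R} {i : ℤ} (a : A.X i) (x : B.X (i + 1)) (b : B.X i) :
    (padFst A B).f i (padMk a x b) = a := rfl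

/-- The chain map `padded A B ⟶ padded A' B` induced by a chain map `A ⟶ A'`. -/
def padMap {A A' : Cplx R} (f : A ⟶ A') (B : Cplx R) : padded A B ⟶ padded A' B where
  f i := ModuleCat.ofHom ((f.f i).hom.prodMap (LinearMap.id : B.X (i + 1) × B.X i →ₗ[R] _))
  comm' := hom_ext_of_succ _ fun j p => by
    obtain ⟨a, x, b, rfl⟩ := padMk_surj p
    change _ = (padded A' B).d _ _ (padMk (f.f _ a) x b)
    rw [padded_d, padded_d, ← f_d_apply]
    rfl

/-- The chain map `padded A B ⟶ B` given by a chain map `A ⟶ B`; it is surjective. -/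
def padDesc {A B : Cplx R} (f : A ⟶ B) : padded A B ⟶ B where
  f i := ModuleCat.ofHom ((f.f i).hom.coprod (LinearMap.snd R (B.X (i + 1)) (B.X i)))
  comm' := hom_ext_of_succ _ fun j p => by
    obtain ⟨a, x, b, rfl⟩ := padMk_surj p
    rw [padded_d]
    change f.f j (A.d (j + 1) j a) + B.d (j + 1) j b = B.d (j + 1) j (f.f (j + 1) a + b)
    rw [map_add, f_d_apply]

theorem padDesc_apply {A B : Cplx R} (f : A ⟶ B) {i : ℤ} (a : A.X i) (x : B.X (i + 1))
    (b : B.X i) : (padDesc f).f i (padMk a x b) = f.f i a + b := rfl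

theorem padDesc_surjective {A B : Cplx R} (f : A ⟶ B) (i : ℤ) :
    Function.Surjective ((padDesc f).f i) := fun b =>
  ⟨padMk 0 0 b, by rw [padDesc_apply, map_zero, zero_add]⟩

/-- A homotopy from the identity of `padded A B` to the projection onto `A`. -/
def padHtpy (A B : Cplx R) (i : ℤ) : (padded A B).X i ⟶ (padded A B).X (i + 1) :=
  (ModuleCat.ofHom ((LinearMap.inr R (A.X (i + 1)) _).comp
    ((LinearMap.inr R (B.X (i + 1 + 1)) (B.X (i + 1))).comp
      ((LinearMap.fst R (B.X (i + 1)) (B.X i)).comp (LinearMap.snd R (A.X i) _)))) :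
    ModuleCat.of R (A.X i × B.X (i + 1) × B.X i) ⟶
      ModuleCat.of R (A.X (i + 1) × B.X (i + 1 + 1) × B.X (i + 1)))

theorem padHtpy_apply {A B : Cplx R} {i : ℤ} (a : A.X i) (x : B.X (i + 1)) (b : B.X i) :
    padHtpy A B i (padMk a x b) = padMk 0 0 x := rfl

theorem padHtpy_spec {A B : Cplx R} {j : ℤ} (p : (padded A B).X (j + 1)) :
    (padded A B).d (j + 1 + 1) (j + 1) (padHtpy A B (j + 1) p) +
      padHtpy A B j ((padded A B).d (j + 1) j p) =
    p - (padIn A B).f (j + 1) ((padFst A B).f (j + 1) p) := by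
  obtain ⟨a, x, b, rfl⟩ := padMk_surj p
  rw [padHtpy_apply, padded_d, padded_d, padHtpy_apply, padFst_apply, padIn_apply, padMk_add,
    padMk_sub, padMk_inj]
  refine ⟨by simp only [map_zero]; abel, by simp only [map_zero]; abel, by abel⟩

/-- The kernel consists of the triples `(a, x, -f a)`, so up to shift and signs it is the mapping
cone of `f`. -/
theorem padDesc_kerExact {A B : Cplx R} (f : A ⟶ B) (hf : QuasiIso f) : KerExact (padDesc f) := by
  rw [quasiIso_iff_qisoElt] at hf
  rintro _ _ k rfl rfl p hp hp'
  obtain ⟨a, x, b, rfl⟩ := padMk_surj p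
  rw [padded_d, padMk_zero, padMk_inj] at hp
  rw [padDesc_apply] at hp'
  obtain ⟨ha, hx, -⟩ := hp
  obtain rfl : b = - f.f _ a := eq_neg_of_add_eq_zero_right hp'
  obtain ⟨a', rfl⟩ := (hf (k + 1 + 1) (k + 1) k rfl rfl).1 a ha
    ⟨-x, by rw [map_neg, ← sub_eq_zero.1 hx, neg_neg]⟩
  obtain ⟨c, hc, w, hw⟩ := (hf (k + 1 + 1 + 1) (k + 1 + 1) (k + 1) rfl rfl).2 (f.f _ a' + x)
    (by rw [map_add, ← f_d_apply, ← sub_eq_zero.1 hx]; abel)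
  refine ⟨padMk (a' - c) (-w) (-(f.f _ (a' - c))), by rw [padDesc_apply]; abel, ?_⟩
  rw [padded_d, padMk_inj]
  refine ⟨by rw [map_sub, hc, sub_zero], ?_, ?_⟩
  · rw [map_sub, map_neg, sub_neg_eq_add, neg_sub, sub_add_eq_add_sub, ← hw]
    abel
  · rw [map_neg, ← f_d_apply, map_sub, hc, sub_zero]

theorem padded_projective {A B : Cplx R} (hA : ∀ i, Module.Projective R (A.X i))
    (hB : ∀ i, Module.Projective R (B.X i)) (i : ℤ) : Module.Projective R ((padded A B).X i) := by
  have := hA i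
  have := hB i
  have := hB (i + 1)
  exact inferInstanceAs (Module.Projective R (A.X i × B.X (i + 1) × B.X i))

end Padded

/-! ### Lifting and null-homotopies for DG-projective complexes -/

section DGProjective

variable {R : Type u} [Ring R]

/-- A chain map from a DG-projective complex to an acyclic complex is null-homotopic. -/
theorem IsDGProjective.exists_nullHomotopy {P Y : Cplx R} (hP : IsDGProjective P)
    (hY : Y.Acyclic) (u : P ⟶ Y) :
    ∃ k : ∀ i, P.X i ⟶ Y.X (i + 1), ∀ j,
      u.f (j + 1) = k (j + 1) ≫ Y.d (j + 1 + 1) (j + 1) + P.d (j + 1) j ≫ k j := by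
  let v : HomDeg P Y 0 := fun p => u.f p.1.1 ≫ eqToHom (by rw [← p.2, add_zero])
  have hv : homDiff P Y 0 (0 - 1) (by omega) v = 0 := by
    funext p
    obtain ⟨⟨i, j⟩, h⟩ := p
    obtain rfl : i = j + 1 := by dsimp only at h; omega
    simp [homDiff, v]
  obtain ⟨s, hs⟩ := (hP.hom_exact Y hY 0 v).1 hv
  refine ⟨fun i => s ⟨(i, i + 1), by simp⟩, fun j => ?_⟩
  have h := congrFun hs ⟨(j + 1, j + 1), by simp⟩
  have : ∀ m (hm : m = j), P.d (j + 1) m ≫ s ⟨(m, j + 1), by simp [hm]⟩ =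
      P.d (j + 1) j ≫ s ⟨(j, j + 1), by simp⟩ := by
    rintro m rfl
    rfl
  simp only [homDiff, v, eqToHom_refl, Category.comp_id] at h
  rw [this _ (by omega)] at h
  rw [← h]
  simp

/-- A cocycle of degree `-1` from a DG-projective complex to an acyclic complex is a
coboundary. -/
theorem IsDGProjective.exists_of_cocycle {P Y : Cplx R} (hP : IsDGProjective P)
    (hY : Y.Acyclic) (δ : ∀ i j, P.X i ⟶ Y.X j)
    (hδ : ∀ i j k, j + 1 = i → k + 1 = j → δ i j ≫ Y.d j k + P.d i j ≫ δ j k = 0) :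
    ∃ h : ∀ i, P.X i ⟶ Y.X i, ∀ j,
      h (j + 1) ≫ Y.d (j + 1) j - P.d (j + 1) j ≫ h j = δ (j + 1) j := by
  let v : HomDeg P Y (-1) := fun p => δ p.1.1 p.1.2
  have hv : homDiff P Y (-1) (-1 - 1) (by omega) v = 0 := by
    funext p
    obtain ⟨⟨i, j⟩, h⟩ := p
    obtain rfl : i = j + 1 + 1 := by dsimp only at h; omega
    have e : ∀ m (hm : m = j + 1), P.d (j + 1 + 1) m ≫ δ m j =
        P.d (j + 1 + 1) (j + 1) ≫ δ (j + 1) j := by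
      rintro m rfl
      rfl
    have := hδ (j + 1 + 1) (j + 1) j rfl rfl
    simp [homDiff, v, e, this]
  obtain ⟨s, hs⟩ := (hP.hom_exact Y hY (-1) v).1 hv
  refine ⟨fun i => s ⟨(i, i), by simp⟩, fun j => ?_⟩
  have h := congrFun hs ⟨(j + 1, j), by simp⟩
  have : ∀ m (hm : m = j), P.d (j + 1) m ≫ s ⟨(m, j), by simp [hm]⟩ =
      P.d (j + 1) j ≫ s ⟨(j, j), by simp⟩ := by
    rintro m rfl
    rfl
  simp only [homDiff, v] at h
  rw [this _ (by omega)] at h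
  rw [← h]
  simp

/-- Lifting along a surjection out of a projective module. -/
theorem exists_lift_of_surjective {P M N : ModuleCat.{u} R} (hP : Module.Projective R P)
    (f : M ⟶ N) (g : P ⟶ N) (hf : Function.Surjective f) : ∃ h : P ⟶ M, h ≫ f = g := by
  obtain ⟨h, hh⟩ := Module.projective_lifting_property f.hom g.hom hf
  exact ⟨ModuleCat.ofHom h, ModuleCat.hom_ext hh⟩

/-- Lifting out of a projective module, for a map with values in the image. -/
theorem exists_lift_of_forall {P M N : ModuleCat.{u} R} (hP : Module.Projective R P)
    (f : M ⟶ N) (g : P ⟶ N) (hg : ∀ x, ∃ y, f y = g x) : ∃ h : P ⟶ M, ∀ x, f (h x) = g x := by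
  obtain ⟨h, hh⟩ := Module.projective_lifting_property f.hom.rangeRestrict
    (g.hom.codRestrict (LinearMap.range f.hom) hg) f.hom.surjective_rangeRestrict
  exact ⟨ModuleCat.ofHom h, fun x => congrArg Subtype.val (LinearMap.congr_fun hh x)⟩

/-- The factorization of a map through the kernel of a chain map. -/
def kerLift {X Y : Cplx R} (f : X ⟶ Y) {M : ModuleCat.{u} R} {i : ℤ} (g : M ⟶ X.X i)
    (h : g ≫ f.f i = 0) : M ⟶ (kerCplx f).X i :=
  ModuleCat.ofHom (g.hom.codRestrict (LinearMap.ker (f.f i).hom) fun x => congr($h x))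

theorem kerLift_ι {X Y : Cplx R} (f : X ⟶ Y) {M : ModuleCat.{u} R} {i : ℤ} (g : M ⟶ X.X i)
    (h : g ≫ f.f i = 0) : kerLift f g h ≫ (kerι f).f i = g := rfl

theorem kerι_mono {X Y : Cplx R} (f : X ⟶ Y) (i : ℤ) : Mono ((kerι f).f i) :=
  (ModuleCat.mono_iff_injective _).2 Subtype.val_injective

theorem kerι_comp {X Y : Cplx R} (f : X ⟶ Y) (i : ℤ) : (kerι f).f i ≫ f.f i = 0 :=
  ModuleCat.hom_ext (LinearMap.ext fun x => (x : LinearMap.ker (f.f i).hom).2)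

/-- DG-projective complexes have the lifting property with respect to surjective
quasi-isomorphisms. -/
theorem IsDGProjective.exists_lift {P Q B : Cplx R} (hP : IsDGProjective P) (ψ : Q ⟶ B)
    (hs : ∀ i, Function.Surjective (ψ.f i)) (hk : KerExact ψ) (b : P ⟶ B) :
    ∃ l : P ⟶ Q, l ≫ ψ = b := by
  have H : ∀ i, ∃ g : P.X i ⟶ Q.X i, g ≫ ψ.f i = b.f i := fun i =>
    exists_lift_of_surjective (hP.projective i) _ _ (hs i)
  choose g hg using H
  -- The failure of the degreewise lifts to commute with the differentials is a cocycle with values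
  -- in the exact kernel of `ψ`. Writing it as a coboundary gives the correction to `g`.
  have hg' : ∀ i j, (g i ≫ Q.d i j - P.d i j ≫ g j) ≫ ψ.f j = 0 := fun i j => by
    rw [Preadditive.sub_comp, Category.assoc, Category.assoc, ← ψ.comm, reassoc_of% hg, hg,
      b.comm, sub_self]
  obtain ⟨h, hh⟩ := hP.exists_of_cocycle (kerCplx_acyclic ψ hk)
    (fun i j => kerLift ψ _ (hg' i j)) (fun i j k _ _ => by
      have := kerι_mono ψ k
      rw [← cancel_mono ((kerι ψ).f k), Preadditive.add_comp, Category.assoc, Category.assoc,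
        ← (kerι ψ).comm, kerLift_ι, reassoc_of% (kerLift_ι ψ _ (hg' i j))]
      simp)
  refine ⟨{ f := fun i => g i - h i ≫ (kerι ψ).f i, comm' := ?_ }, ?_⟩
  · rintro _ j rfl
    have := congr($(hh j) ≫ (kerι ψ).f j)
    rw [kerLift_ι, Preadditive.sub_comp, Category.assoc, Category.assoc, ← (kerι ψ).comm] at this
    rw [Preadditive.sub_comp, Preadditive.comp_sub, Category.assoc, sub_eq_sub_iff_sub_eq_sub]
    exact this.symm
  · ext1 i
    change (g i - h i ≫ (kerι ψ).f i) ≫ ψ.f i = b.f i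
    rw [Preadditive.sub_comp, Category.assoc, kerι_comp, comp_zero, sub_zero, hg]

/-- A chain map from a DG-projective complex with values in an exact kernel is null-homotopic
in that kernel. -/
theorem IsDGProjective.exists_nullHomotopy_ker {P Q B : Cplx R} (hP : IsDGProjective P)
    (ψ : Q ⟶ B) (hk : KerExact ψ) (u : P ⟶ Q) (hu : u ≫ ψ = 0) :
    ∃ k : ∀ i, P.X i ⟶ Q.X (i + 1), (∀ i, k i ≫ ψ.f (i + 1) = 0) ∧ ∀ j,
      u.f (j + 1) = k (j + 1) ≫ Q.d (j + 1 + 1) (j + 1) + P.d (j + 1) j ≫ k j := by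
  have hu' : ∀ i, u.f i ≫ ψ.f i = 0 := fun i => congr(($hu).f i)
  obtain ⟨k, hk⟩ := hP.exists_nullHomotopy (kerCplx_acyclic ψ hk)
    ({ f := fun i => kerLift ψ (u.f i) (hu' i)
       comm' := fun i j _ => by
        have := kerι_mono ψ j
        rw [← cancel_mono ((kerι ψ).f j), Category.assoc, Category.assoc, ← (kerι ψ).comm,
          kerLift_ι, reassoc_of% (kerLift_ι ψ _ (hu' i)), u.comm] } : P ⟶ kerCplx ψ)
  refine ⟨fun i => k i ≫ (kerι ψ).f (i + 1), fun i => by rw [Category.assoc, kerι_comp, comp_zero],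
    fun j => ?_⟩
  have := congr($(hk j) ≫ (kerι ψ).f (j + 1))
  rw [Preadditive.add_comp, Category.assoc, Category.assoc, ← (kerι ψ).comm] at this
  rw [Category.assoc]
  exact this

end DGProjective

/-! ### Totally acyclic complexes: retracts, padding, splitting off contractible summands -/

section TotallyAcyclic

variable {R : Type u} [Ring R]

theorem IsTotallyFAcyclic.exists_extension {T : Cplx R} (hT : IsTotallyFAcyclic T)
    {F : ModuleCat.{u} R} (hF : IsFlat R F) {i j k : ℤ} (hij : j + 1 = i) (hjk : k + 1 = j)
    (g : T.X j ⟶ F) (hg : T.d i j ≫ g = 0) : ∃ g' : T.X k ⟶ F, T.d j k ≫ g' = g := by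
  subst hij
  obtain rfl : k = j - 1 := by omega
  exact (hT.hom_exact F hF j g).1 hg

theorem IsTotallyFAcyclic.of_extension {T : Cplx R} (hp : ∀ n, Module.Projective R (T.X n))
    (hex : T.Acyclic) (h : ∀ F : ModuleCat.{u} R, IsFlat R F → ∀ k : ℤ,
      ∀ g : T.X (k + 1) ⟶ F, T.d (k + 1 + 1) (k + 1) ≫ g = 0 →
        ∃ g' : T.X k ⟶ F, T.d (k + 1) k ≫ g' = g) : IsTotallyFAcyclic T where
  projective := hp
  exact := hex
  hom_exact F hF n g := by
    obtain ⟨k, rfl⟩ : ∃ k, n = k + 1 := ⟨n - 1, by omega⟩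
    obtain ⟨m, hm⟩ : ∃ m, m = k + 1 - 1 := ⟨_, rfl⟩
    rw [← hm]
    obtain rfl : m = k := by omega
    refine ⟨fun hg => h F hF m g hg, ?_⟩
    rintro ⟨g', rfl⟩
    dsimp only
    rw [← Category.assoc, T.d_comp_d, zero_comp]

theorem retract_apply {X Y : Cplx R} {i : X ⟶ Y} {p : Y ⟶ X} (h : i ≫ p = 𝟙 X) {n : ℤ}
    (x : X.X n) : p.f n (i.f n x) = x :=
  congr(($h).f n x)

theorem IsTotallyFAcyclic.of_retract {T E : Cplx R} (hE : IsTotallyFAcyclic E) (i : T ⟶ E)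
    (p : E ⟶ T) (h : i ≫ p = 𝟙 T) : IsTotallyFAcyclic T := by
  refine .of_extension (fun n => ?_) ((acyclic_iff_exactElt T).2 ?_) fun F hF k g hg => ?_
  · have := hE.projective n
    exact Module.Projective.of_split (i.f n).hom (p.f n).hom
      (LinearMap.ext fun x => retract_apply h x)
  · intro a b c hab hbc x hx
    obtain ⟨y, hy⟩ := (acyclic_iff_exactElt E).1 hE.exact a b c hab hbc (i.f b x)
      (by rw [← f_d_apply, hx, map_zero])
    exact ⟨p.f a y, by rw [← f_d_apply, hy, retract_apply h]⟩
  · obtain ⟨g', hg'⟩ := hE.exists_extension hF rfl rfl (p.f (k + 1) ≫ g)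
      (by rw [← p.comm_assoc, hg, comp_zero])
    refine ⟨i.f k ≫ g', ?_⟩
    rw [← i.comm_assoc, hg', ← Category.assoc, ← HomologicalComplex.comp_f, h]
    exact Category.id_comp _

/-- The homotopy `padHtpy` deforms the identity to the projection onto `T`, so that both exactness
and the extension property reduce to those of `T`. -/
theorem IsTotallyFAcyclic.to_padded {T B : Cplx R} (hT : IsTotallyFAcyclic T)
    (hB : ∀ n, Module.Projective R (B.X n)) : IsTotallyFAcyclic (padded T B) := by
  refine .of_extension (padded_projective hT.projective hB) ((acyclic_iff_exactElt _).2 ?_)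
    fun F hF k g hg => ?_
  · rintro _ _ k rfl rfl x hx
    obtain ⟨a, ha⟩ := (acyclic_iff_exactElt T).1 hT.exact _ (k + 1) k rfl rfl
      ((padFst T B).f _ x) (by rw [← f_d_apply, hx, map_zero])
    have := padHtpy_spec x
    rw [hx, map_zero, add_zero, ← ha, f_d_apply] at this
    exact ⟨padHtpy T B (k + 1) x + (padIn T B).f _ a, by rw [map_add, this]; abel⟩
  · obtain ⟨g', hg'⟩ := hT.exists_extension hF rfl rfl ((padIn T B).f (k + 1) ≫ g)
      (by rw [← (padIn T B).comm_assoc, hg, comp_zero])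
    refine ⟨(padFst T B).f k ≫ g' + padHtpy T B k ≫ g, ?_⟩
    rw [Preadditive.comp_add, ← (padFst T B).comm_assoc, hg']
    refine ModuleCat.hom_ext (LinearMap.ext fun x => ?_)
    have h1 := congr(g $(padHtpy_spec x))
    have h2 : g _ = 0 := congr($hg (padHtpy T B (k + 1) x))
    rw [map_add, map_sub] at h1
    change g ((padIn T B).f _ ((padFst T B).f _ x)) +
      g (padHtpy T B k ((padded T B).d (k + 1) k x)) = g x
    have h3 : g ((padded T B).d (k + 1 + 1) (k + 1) (padHtpy T B (k + 1) x)) = 0 := h2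
    rw [h3, zero_add] at h1
    rw [h1]
    abel

/-- The chain endomorphism `d s + s d` given by a family of maps `s` of degree one. -/
theorem exists_hom_of_homotopy {E : Cplx R} (s : ∀ i, E.X i ⟶ E.X (i + 1)) :
    ∃ r : E ⟶ E, ∀ (j : ℤ) (x : E.X (j + 1)), r.f (j + 1) x =
      E.d (j + 1 + 1) (j + 1) (s (j + 1) x) + s j (E.d (j + 1) j x) := by
  refine ⟨Homotopy.nullHomotopicMap'
    (fun i j h => s i ≫ eqToHom (congrArg E.X (show i + 1 = j from h))), fun j x => ?_⟩
  rw [Homotopy.nullHomotopicMap'_f (k₂ := j + 1 + 1) (k₀ := j) rfl rfl, eqToHom_refl,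
    eqToHom_refl, Category.comp_id, Category.comp_id]
  exact add_comm _ _

/-- Splitting off a contractible summand: if the kernel of a surjection `ε : E ⟶ P` onto a complex
of projective modules is contractible in degrees `≥ n`, a direct summand of `E` maps onto `P`,
bijectively in degrees `≥ n`. -/
theorem IsTotallyFAcyclic.exists_of_contraction {E P : Cplx R} (hE : IsTotallyFAcyclic E)
    (hP : ∀ n, Module.Projective R (P.X n)) (ε : E ⟶ P) (hε : ∀ i, Function.Surjective (ε.f i))
    (n : ℤ) (S : ∀ i, E.X i ⟶ E.X (i + 1))
    (hS : ∀ i, n ≤ i + 1 → ∀ x, ε.f i x = 0 → ε.f (i + 1) (S i x) = 0)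
    (hS' : ∀ j (x : E.X (j + 1)), n ≤ j + 1 → ε.f (j + 1) x = 0 →
      E.d (j + 1 + 1) (j + 1) (S (j + 1) x) + S j (E.d (j + 1) j x) = x) :
    ∃ (T : Cplx R) (τ : T ⟶ P), IsTotallyFAcyclic T ∧
      (∀ i, Function.Surjective (τ.f i)) ∧ ∀ i, n ≤ i → Function.Bijective (τ.f i) := by
  have H : ∀ i, ∃ ρ : E.X i ⟶ E.X i, (∀ x, ε.f i (ρ x) = 0) ∧ ∀ x, ε.f i x = 0 → ρ x = x := by
    intro i
    obtain ⟨σ, hσ⟩ := exists_lift_of_surjective (hP i) (ε.f i) (𝟙 _) (hε i)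
    refine ⟨𝟙 _ - ε.f i ≫ σ, fun x => ?_, fun x hx => ?_⟩
    · change ε.f i (x - σ (ε.f i x)) = 0
      have : ε.f i (σ (ε.f i x)) = ε.f i x := congr($hσ _)
      rw [map_sub, this, sub_self]
    · change x - σ (ε.f i x) = x
      rw [hx, map_zero, sub_zero]
  choose ρ hρ hρ' using H
  -- Precomposing with the retraction `ρ` onto the kernel makes `s` take values in the kernel
  -- everywhere. The component out of degree `n - 1` is kept, since `ds + sd` in degree `n` uses it;
  -- all lower ones are zero.
  let s : ∀ i, E.X i ⟶ E.X (i + 1) := fun i => if n ≤ i + 1 then ρ i ≫ S i else 0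
  have hs0 : ∀ i, ¬ n ≤ i + 1 → ∀ x, s i x = 0 := fun i hi x => by
    simp only [s, if_neg hi]
    rfl
  have hs1 : ∀ i, n ≤ i + 1 → ∀ x, s i x = S i (ρ i x) := fun i hi x => by
    simp only [s, if_pos hi]
    rfl
  have hsε : ∀ i x, ε.f (i + 1) (s i x) = 0 := fun i x => by
    by_cases hi : n ≤ i + 1
    · rw [hs1 i hi, hS i hi _ (hρ i x)]
    · rw [hs0 i hi, map_zero]
  obtain ⟨r, hr⟩ := exists_hom_of_homotopy s
  have hrε : ∀ i x, ε.f i (r.f i x) = 0 := fun i x => by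
    obtain ⟨j, rfl⟩ : ∃ j, i = j + 1 := ⟨i - 1, by omega⟩
    rw [hr, map_add, f_d_apply, hsε, hsε, map_zero, add_zero]
  have hrid : ∀ i x, n ≤ i → ε.f i x = 0 → r.f i x = x := fun i x hi hx => by
    obtain ⟨j, rfl⟩ : ∃ j, i = j + 1 := ⟨i - 1, by omega⟩
    rw [hr, hs1 _ (by omega), hs1 _ hi, hρ' _ x hx, hρ' _ _ (by rw [f_d_apply, hx, map_zero]),
      hS' j x hi hx]
  -- In degrees `≥ n`, `r` maps into the kernel, where it is the identity. In degree `n - 1` it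
  -- reduces to `ds`, and `rds = drs = ds` because `s` lands in the kernel in degree `n`. Below that
  -- it vanishes.
  have hrr : r ≫ r = r := by
    ext i x
    change r.f i (r.f i x) = r.f i x
    by_cases hi : n ≤ i
    · exact hrid i _ hi (hrε i x)
    · obtain ⟨j, rfl⟩ : ∃ j, i = j + 1 := ⟨i - 1, by omega⟩
      have e : r.f (j + 1) x = E.d (j + 1 + 1) (j + 1) (s (j + 1) x) := by
        rw [hr, hs0 j hi, add_zero]
      rw [e, f_d_apply]
      by_cases hj : n ≤ j + 1 + 1
      · rw [hrid _ _ hj (hsε _ _)]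
      · rw [hs0 _ hj, map_zero, map_zero]
  -- The summand sought is the image of `1 - r`; as `r` has values in the kernel of `ε`, it still
  -- maps onto `P`.
  obtain ⟨T, i, p, hip, hpi⟩ := IsIdempotentComplete.idempotents_split E (𝟙 E - r)
    (by simp [hrr])
  have hpi' : ∀ n x, i.f n (p.f n x) = x - r.f n x := fun n x => congr(($hpi).f n x)
  have hsurj : ∀ k, Function.Surjective ((i ≫ ε).f k) := fun k y => by
    obtain ⟨x, rfl⟩ := hε k y
    refine ⟨p.f k x, ?_⟩
    change ε.f k (i.f k (p.f k x)) = _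
    rw [hpi', map_sub, hrε, sub_zero]
  refine ⟨T, i ≫ ε, hE.of_retract i p hip, hsurj, fun k hk => ⟨?_, hsurj k⟩⟩
  refine (injective_iff_map_eq_zero _).2 fun x hx => ?_
  have h1 := hrid k (i.f k x) hk hx
  have h2 := hpi' k (i.f k x)
  rw [retract_apply hip, h1, sub_self] at h2
  rw [← retract_apply hip x, h2, map_zero]

/-- Replacing the modules of a complex by isomorphic ones. -/
def replaceX (T : Cplx R) (Y : ℤ → ModuleCat.{u} R) (e : ∀ i, Y i ≅ T.X i) : Cplx R where
  X := Y
  d i j := (e i).hom ≫ T.d i j ≫ (e j).inv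
  shape i j h := by simp [T.shape i j h]
  d_comp_d' i j k _ _ := by simp

/-- A complex is isomorphic to the one obtained by replacing the modules. -/
def replaceXIso (T : Cplx R) (Y : ℤ → ModuleCat.{u} R) (e : ∀ i, Y i ≅ T.X i) :
    replaceX T Y e ≅ T :=
  HomologicalComplex.Hom.isoOfComponents e fun i j _ => by simp [replaceX]

/-- A surjective chain map from a totally acyclic complex, bijective in degrees `≥ n`, may be
replaced by one which is the identity in these degrees. -/
theorem IsTotallyFAcyclic.exists_eqToHom {T P : Cplx R} (hT : IsTotallyFAcyclic T) (τ : T ⟶ P)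
    (hs : ∀ i, Function.Surjective (τ.f i)) (n : ℤ)
    (hb : ∀ i, n ≤ i → Function.Bijective (τ.f i)) :
    ∃ (T' : Cplx R) (τ' : T' ⟶ P), IsTotallyFAcyclic T' ∧
      (∀ i, Function.Surjective (τ'.f i)) ∧
      ∀ i, n ≤ i → ∃ h : T'.X i = P.X i, τ'.f i = eqToHom h := by
  classical
  have hiso : ∀ i, n ≤ i → IsIso (τ.f i) := fun i hi =>
    (ConcreteCategory.isIso_iff_bijective _).2 (hb i hi)
  let Y : ℤ → ModuleCat.{u} R := fun i => if n ≤ i then P.X i else T.X i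
  let e : ∀ i, Y i ≅ T.X i := fun i =>
    if h : n ≤ i then
      have := hiso i h
      eqToIso (if_pos h) ≪≫ (asIso (τ.f i)).symm
    else eqToIso (if_neg h)
  refine ⟨replaceX T Y e, (replaceXIso T Y e).hom ≫ τ,
    hT.of_retract (replaceXIso T Y e).hom (replaceXIso T Y e).inv (Iso.hom_inv_id _),
    fun i => ?_, fun i hi => ⟨if_pos hi, ?_⟩⟩
  · change Function.Surjective ((e i).hom ≫ τ.f i)
    rw [ConcreteCategory.coe_comp]
    exact (hs i).comp (ConcreteCategory.bijective_of_isIso (e i).hom).2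
  · change (e i).hom ≫ τ.f i = _
    have := hiso i hi
    simp [e, dif_pos hi]
    rfl

end TotallyAcyclic

/-! ### Projective modules are flat -/

section Flat

variable {R : Type u} [Ring R]

/-- For `s : M → R^(M)`, the map `N ⊗_R M → N^(M)` given by `x ⊗ m ↦ x · s(m)`. -/
noncomputable def coordMap {M : Type u} [AddCommGroup M] [Module R M] (s : M →ₗ[R] M →₀ R)
    (N : Type u) [AddCommGroup N] [Module Rᵐᵒᵖ N] : BalancedTensor R N M →+ (M →₀ N) :=
  QuotientAddGroup.lift _
    (TensorProduct.liftAddHom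
      (AddMonoidHom.mk' (fun x : N => AddMonoidHom.mk' (fun m : M =>
          (s m).mapRange (fun r => MulOpposite.op r • x) (by simp))
        fun m m' => by
          ext t
          simp [add_smul])
        fun x x' => by
          ext m t
          simp)
      fun k x m => by
        rw [map_zsmul, map_zsmul]
        rfl)
    ((AddSubgroup.closure_le _).2 (by
      rintro _ ⟨x, r, m, rfl⟩
      change _ = _
      rw [map_sub, sub_eq_zero]
      ext t
      simp [mul_smul]))

/-- The map `N^(M) → N ⊗_R M` that sends `x` in position `m` to `x ⊗ m` is a left inverse, because
`s` is a section of the free cover of `M`. -/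
theorem coordMap_injective {M : Type u} [AddCommGroup M] [Module R M] (s : M →ₗ[R] M →₀ R)
    (hs : ∀ m, Finsupp.linearCombination R id (s m) = m)
    (N : Type u) [AddCommGroup N] [Module Rᵐᵒᵖ N] : Function.Injective (coordMap s N) := by
  let Ψ : (M →₀ N) →+ BalancedTensor R N M := Finsupp.liftAddHom fun m =>
    (QuotientAddGroup.mk' (balancedRelations R N M)).comp
      ((TensorProduct.mk ℤ N M).flip m).toAddMonoidHom
  have hΨ : ∀ t, Ψ (coordMap s N t) = t := by
    intro t
    obtain ⟨t, rfl⟩ := QuotientAddGroup.mk_surjective t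
    induction t using TensorProduct.induction_on with
    | zero => exact (congrArg Ψ (map_zero (coordMap s N))).trans (map_zero Ψ)
    | add a b ha hb => 
      rw [QuotientAddGroup.mk_add, map_add, map_add, ha, hb]
    | tmul x m =>
      have key : ∀ (g : M →₀ R), Ψ (g.mapRange (fun r => MulOpposite.op r • x) (by simp)) =
          QuotientAddGroup.mk (x ⊗ₜ[ℤ] (Finsupp.linearCombination R id g)) := by
        intro g
        induction g using Finsupp.induction_linear with
        | zero => simp
        | add g h hg hh =>
          rw [Finsupp.mapRange_add (by intro a b; simp [add_smul]), map_add, hg, hh, map_add,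
            TensorProduct.tmul_add, QuotientAddGroup.mk_add]
        | single m r =>
          rw [Finsupp.mapRange_single, Finsupp.liftAddHom_apply_single,
            Finsupp.linearCombination_single]
          refine (QuotientAddGroup.eq_iff_sub_mem).2 (AddSubgroup.subset_closure ⟨x, r, m, rfl⟩)
      exact (key (s m)).trans (by rw [hs])
  exact Function.LeftInverse.injective hΨ

/-- The embedding `N ⊗_R M → N^(M)` is natural in `N`, and applying an injective `f` coordinatewise
is injective. -/
theorem isFlat_of_projective (M : Type u) [AddCommGroup M] [Module R M]
    (hM : Module.Projective R M) : IsFlat R M := by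
  obtain ⟨s, hs⟩ := hM.out
  intro N N' _ _ _ _ f hf
  refine (injective_iff_map_eq_zero _).2 fun t ht => ?_
  have key : ∀ t, coordMap s N' (BalancedTensor.map R f M t) =
      Finsupp.mapRange.addMonoidHom f.toAddMonoidHom (coordMap s N t) := by
    intro t
    obtain ⟨t, rfl⟩ := QuotientAddGroup.mk_surjective t
    induction t using TensorProduct.induction_on with
    | zero => 
      rw [QuotientAddGroup.mk_zero, map_zero, map_zero, map_zero, map_zero]
    | add a b ha hb => 
      rw [QuotientAddGroup.mk_add, map_add, map_add, ha, hb, map_add, map_add]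
    | tmul x m =>
      ext y
      exact (map_smul f (MulOpposite.op (s m y)) x).symm
  apply coordMap_injective s hs N
  rw [map_zero]
  have := key t
  rw [ht, map_zero] at this
  ext y
  exact hf (by rw [Finsupp.zero_apply, map_zero]; exact (DFunLike.congr_fun this y).symm)

end Flat

/-! ### Comparison of DG-projective resolutions -/

section Resolutions

variable {R : Type u} [Ring R]

/-- DG-projective resolutions of the same complex are related by a quasi-isomorphism. -/
theorem IsDGProjectiveResolution.exists_quasiIso {P P' X : Cplx R} {π : P ⟶ X} {π' : P' ⟶ X}
    (hπ : IsDGProjectiveResolution π) (hπ' : IsDGProjectiveResolution π') :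
    ∃ f : P ⟶ P', QuasiIso f := by
  obtain ⟨l, hl⟩ := hπ.dgProjective.exists_lift (padDesc π') (padDesc_surjective π')
    (padDesc_kerExact π' hπ'.quasiIso) π
  refine ⟨l ≫ padFst P' X, ?_⟩
  have h := (quasiIso_iff_qisoElt π).1 hπ.quasiIso
  have h' := (quasiIso_iff_qisoElt π').1 hπ'.quasiIso
  have hπl : ∀ i x, (padDesc π').f i (l.f i x) = π.f i x := fun i x => congr(($hl).f i x)
  rw [quasiIso_iff_qisoElt]
  rintro _ _ k rfl rfl
  -- The middle coordinate of the lift `l` is a homotopy between `π` and the composite of `π'` with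
  -- the comparison map; on cycles the two therefore differ by a boundary.
  have key : ∀ x, P.d (k + 1) k x = 0 →
      ∃ v, π.f (k + 1) x = π'.f (k + 1) ((l ≫ padFst P' X).f (k + 1) x) +
        X.d (k + 1 + 1) (k + 1) v := by
    intro x hx
    obtain ⟨a, v, b, hv⟩ := padMk_surj (l.f (k + 1) x)
    have h1 : (padded P' X).d (k + 1) k (l.f (k + 1) x) = 0 := by
      rw [← f_d_apply, hx, map_zero]
    rw [hv, padded_d, padMk_zero, padMk_inj] at h1
    refine ⟨v, ?_⟩
    change _ = π'.f (k + 1) ((padFst P' X).f (k + 1) (l.f (k + 1) x)) + _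
    rw [← hπl, hv, padDesc_apply, padFst_apply, sub_eq_zero.1 h1.2.1]
  refine ⟨fun x hx ⟨y, hy⟩ => ?_, fun y hy => ?_⟩
  · obtain ⟨v, hv⟩ := key x hx
    refine (h _ _ _ rfl rfl).1 x hx ⟨π'.f _ y + v, ?_⟩
    rw [hv, map_add, ← hy, f_d_apply]
  · obtain ⟨x, hx, w, hw⟩ := (h _ _ _ rfl rfl).2 (π'.f _ y) (by rw [← f_d_apply, hy, map_zero])
    obtain ⟨v, hv⟩ := key x hx
    obtain ⟨z, hz⟩ := (h' _ _ _ rfl rfl).1 (y - (l ≫ padFst P' X).f (k + 1) x)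
      (by rw [map_sub, hy, ← f_d_apply, hx, map_zero, sub_zero]) ⟨v + w, by
        rw [map_sub, hw, hv, map_add]
        abel⟩
    exact ⟨x, hx, z, by rw [hz]; abel⟩

/-- A quasi-isomorphism `f : P ⟶ P'` of DG-projective complexes yields, on the padded complex, a
section of `padDesc f` and a homotopy from the identity to the corresponding projection. -/
theorem exists_section_homotopy {P P' : Cplx R} (hP : IsDGProjective P) (hP' : IsDGProjective P')
    (f : P ⟶ P') (hf : QuasiIso f) :
    ∃ (g : P' ⟶ padded P P') (h : ∀ i, (padded P P').X i ⟶ (padded P P').X (i + 1)),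
      (∀ i x, (padDesc f).f (i + 1) (h i x) = 0) ∧
      ∀ j x, (padded P P').d (j + 1 + 1) (j + 1) (h (j + 1) x) +
        h j ((padded P P').d (j + 1) j x) = x - g.f (j + 1) ((padDesc f).f (j + 1) x) := by
  have hk := padDesc_kerExact f hf
  obtain ⟨g, hg⟩ := hP'.exists_lift (padDesc f) (padDesc_surjective f) hk (𝟙 P')
  have hr : (𝟙 _ - padDesc f ≫ g) ≫ padDesc f = 0 := by
    rw [Preadditive.sub_comp, Category.assoc, hg, Category.id_comp, Category.comp_id, sub_self]
  obtain ⟨k, hk0, hk1⟩ := hP.exists_nullHomotopy_ker (padDesc f) hk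
    (padIn P P' ≫ (𝟙 _ - padDesc f ≫ g)) (by rw [Category.assoc, hr, comp_zero])
  obtain ⟨r, rdef⟩ : ∃ r, r = 𝟙 _ - padDesc f ≫ g := ⟨_, rfl⟩
  rw [← rdef] at hr hk1
  have hr' : ∀ i x, (padDesc f).f i (r.f i x) = 0 := fun i x => congr(($hr).f i x)
  have rapp : ∀ i x, r.f i x = x - g.f i ((padDesc f).f i x) := fun i x => by
    rw [rdef]
    rfl
  -- With `η` for `padHtpy`, `1 = in ∘ fst + dη + ηd`. Applying `r` leaves `r ∘ in`, null-homotopic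
  -- through `k` by DG-projectivity of `P`, and a term null-homotopic through `r ∘ η`. Both
  -- homotopies stay in the kernel.
  refine ⟨g, fun i => (padFst P P').f i ≫ k i + padHtpy P P' i ≫ r.f (i + 1),
    fun i x => ?_, fun j x => ?_⟩
  · change (padDesc f).f (i + 1) (k i ((padFst P P').f i x) + r.f (i + 1) (padHtpy P P' i x)) = 0
    have : (padDesc f).f (i + 1) (k i ((padFst P P').f i x)) = 0 :=
      congr($(hk0 i) ((padFst P P').f i x))
    rw [map_add, hr', this, add_zero]
  · change (padded P P').d (j + 1 + 1) (j + 1) (k (j + 1) ((padFst P P').f (j + 1) x) +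
        r.f (j + 1 + 1) (padHtpy P P' (j + 1) x)) +
      (k j ((padFst P P').f j ((padded P P').d (j + 1) j x)) +
        r.f (j + 1) (padHtpy P P' j ((padded P P').d (j + 1) j x))) = _
    have h1 : r.f (j + 1) ((padIn P P').f (j + 1) ((padFst P P').f (j + 1) x)) =
        (padded P P').d (j + 1 + 1) (j + 1) (k (j + 1) ((padFst P P').f (j + 1) x)) +
          k j (P.d (j + 1) j ((padFst P P').f (j + 1) x)) :=
      congr($(hk1 j) ((padFst P P').f (j + 1) x))
    have h2 := congr(r.f (j + 1) $(padHtpy_spec x))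
    rw [map_add, map_sub, h1, f_d_apply] at h2
    rw [← rapp, map_add, f_d_apply, ← sub_eq_zero]
    rw [← sub_eq_zero] at h2
    rw [← h2]
    abel

/-- Transport of an `F`-complete resolution to another DG-projective resolution. -/
theorem IsDGProjectiveResolution.exists_totallyFAcyclic {T P P' X : Cplx R} {τ : T ⟶ P}
    {π : P ⟶ X} {π' : P' ⟶ X} (hπ : IsDGProjectiveResolution π)
    (hπ' : IsDGProjectiveResolution π') (hT : IsTotallyFAcyclic T) (n : ℤ)
    (hb : ∀ i, n ≤ i → Function.Bijective (τ.f i)) :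
    ∃ (T' : Cplx R) (τ' : T' ⟶ P'), IsTotallyFAcyclic T' ∧
      (∀ i, Function.Surjective (τ'.f i)) ∧ ∀ i, n ≤ i → Function.Bijective (τ'.f i) := by
  obtain ⟨f, hf⟩ := hπ.exists_quasiIso hπ'
  obtain ⟨g, h, h0, h1⟩ := exists_section_homotopy hπ.dgProjective hπ'.dgProjective f hf
  have hθ : ∀ i, n ≤ i → Function.Bijective ((padMap τ P').f i) := fun i hi =>
    Function.Bijective.prodMap (hb i hi) Function.bijective_id
  -- Pulling `h` back only requires inverting `padMap τ P'` in the target degree `i + 1`, hence the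
  -- range includes `i = n - 1`.
  have H : ∀ i, ∃ S : (padded T P').X i ⟶ (padded T P').X (i + 1), n ≤ i + 1 →
      ∀ x, (padMap τ P').f (i + 1) (S x) = h i ((padMap τ P').f i x) := by
    intro i
    by_cases hi : n ≤ i + 1
    · have : IsIso ((padMap τ P').f (i + 1)) :=
        (ConcreteCategory.isIso_iff_bijective _).2 (hθ _ hi)
      refine ⟨(padMap τ P').f i ≫ h i ≫ inv ((padMap τ P').f (i + 1)), fun _ x => ?_⟩
      exact congr($(show ((padMap τ P').f i ≫ h i ≫ inv ((padMap τ P').f (i + 1))) ≫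
        (padMap τ P').f (i + 1) = (padMap τ P').f i ≫ h i by simp) x)
    · exact ⟨0, fun h => absurd h hi⟩
  choose S hS using H
  have hε : ∀ i x, (padDesc (τ ≫ f)).f i x = (padDesc f).f i ((padMap τ P').f i x) :=
    fun i x => rfl
  refine (hT.to_padded hπ'.dgProjective.projective).exists_of_contraction
    hπ'.dgProjective.projective (padDesc (τ ≫ f)) (padDesc_surjective _) n S
    (fun i hi x _ => by rw [hε, hS i hi, h0]) fun j x hj hx => (hθ _ hj).1 ?_
  rw [map_add, f_d_apply, hS j hj, hS (j + 1) (by omega), f_d_apply, h1, ← hε, hx, map_zero,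
    sub_zero]

end Resolutions

/-! ### From an isomorphism of cokernels to a complete resolution -/

section Construction

variable {R : Type u} [Ring R]

/-- Dependent choice along the integers, in both directions from a given place. -/
theorem exists_int_family {St : ℤ → Type u} (r : ∀ i j, St i → St j → Prop) (n : ℤ) (x₀ : St n)
    (hup : ∀ i, n ≤ i → ∀ x : St i, ∃ y : St (i + 1), r (i + 1) i y x)
    (hdown : ∀ i, i ≤ n → ∀ x : St i, ∃ y : St (i - 1), r i (i - 1) x y) :
    ∃ s : ∀ i, St i, s n = x₀ ∧ ∀ i, r (i + 1) i (s (i + 1)) (s i) := by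
  choose up hup using hup
  choose down hdown using hdown
  let s : ∀ i, St i := fun i => Int.inductionOn' (motive := St) i n x₀ up down
  refine ⟨s, Int.inductionOn'_self, fun i => ?_⟩
  rcases le_or_gt n i with hi | hi
  · have : s (i + 1) = up i hi (s i) := Int.inductionOn'_add_one hi
    rw [this]
    exact hup i hi _
  · have key : ∀ k, k ≤ n → r k (k - 1) (s k) (s (k - 1)) := fun k hk => by
      have : s (k - 1) = down k hk (s k) := Int.inductionOn'_sub_one hk
      rw [this]
      exact hdown k hk _
    have := key (i + 1) (by omega)
    have e : ∀ m, m = i → r (i + 1) m (s (i + 1)) (s m) → r (i + 1) i (s (i + 1)) (s i) := by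
      rintro m rfl
      exact id
    exact e _ (by omega) this

/-- A contraction of the kernel of a surjection in degrees `> m` is obtained from its first
component. -/
theorem IsTotallyFAcyclic.exists_of_initial {E P : Cplx R} (hE : IsTotallyFAcyclic E)
    (hP : ∀ n, Module.Projective R (P.X n)) (ε : E ⟶ P) (hε : ∀ i, Function.Surjective (ε.f i))
    (m : ℤ) (hP' : ∀ k, m + 1 ≤ k → ExactElt P (k + 1 + 1) (k + 1) k)
    (s₀ : E.X m ⟶ E.X (m + 1)) (hs₀ : ∀ x, ε.f m x = 0 → ε.f (m + 1) (s₀ x) = 0)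
    (hs₀' : ∀ x, ε.f (m + 1) x = 0 → E.d (m + 1) m (s₀ (E.d (m + 1) m x)) = E.d (m + 1) m x) :
    ∃ (T : Cplx R) (τ : T ⟶ P), IsTotallyFAcyclic T ∧
      (∀ i, Function.Surjective (τ.f i)) ∧
      ∀ i, m + 1 ≤ i → Function.Bijective (τ.f i) := by
  -- A preimage `y` exists in `E`; its image in `P` is a cycle in degree `≥ m + 2`, hence a
  -- boundary, and subtracting a lifted boundary moves `y` into the kernel.
  have hker : ∀ k, m ≤ k → ∀ x : E.X (k + 1), E.d (k + 1) k x = 0 → ε.f (k + 1) x = 0 →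
      ∃ y : E.X (k + 1 + 1), ε.f (k + 1 + 1) y = 0 ∧ E.d (k + 1 + 1) (k + 1) y = x := by
    intro k hk x hx hx'
    obtain ⟨y, rfl⟩ := (acyclic_iff_exactElt E).1 hE.exact _ _ _ rfl rfl x hx
    rw [f_d_apply] at hx'
    obtain ⟨w, hw⟩ := hP' (k + 1) (by omega) _ hx'
    obtain ⟨v, rfl⟩ := hε _ w
    exact ⟨y - E.d _ _ v, by rw [map_sub, f_d_apply, hw, sub_self],
      by rw [map_sub, d_d_apply, sub_zero]⟩
  -- The identity `d s d = d` on the kernel is the induction invariant: it makes `x - s d x` a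
  -- cycle, so that the next component can be chosen with `d t x = x - s d x`.
  let St : ℤ → Type u := fun i => {s : E.X i ⟶ E.X (i + 1) // m ≤ i →
    (∀ x, ε.f i x = 0 → ε.f (i + 1) (s x) = 0) ∧
    ∀ x, ε.f (i + 1) x = 0 → E.d (i + 1) i (s (E.d (i + 1) i x)) = E.d (i + 1) i x}
  let r : ∀ i j, St i → St j → Prop := fun i j s t => m ≤ j → ∀ x : E.X i, ε.f i x = 0 →
    ∃ e : j + 1 = i, E.d (i + 1) i (s.1 x) + eqToHom (congrArg E.X e) (t.1 (E.d i j x)) = x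
  have hup : ∀ i, m ≤ i → ∀ x : St i, ∃ y : St (i + 1), r (i + 1) i y x := by
    rintro i hi ⟨s, h⟩
    obtain ⟨h1, h2⟩ := h hi
    obtain ⟨σ, hσ⟩ := exists_lift_of_surjective (hP (i + 1)) (ε.f (i + 1)) (𝟙 _) (hε (i + 1))
    obtain ⟨ρ, ρdef⟩ : ∃ ρ, ρ = 𝟙 _ - ε.f (i + 1) ≫ σ := ⟨_, rfl⟩
    have hρ : ∀ x, ε.f (i + 1) (ρ x) = 0 := fun x => by
      have : ε.f (i + 1) (σ (ε.f (i + 1) x)) = ε.f (i + 1) x := congr($hσ _)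
      rw [ρdef]
      change ε.f (i + 1) (x - σ (ε.f (i + 1) x)) = 0
      rw [map_sub, this, sub_self]
    have hρ' : ∀ x, ε.f (i + 1) x = 0 → ρ x = x := fun x hx => by
      rw [ρdef]
      change x - σ (ε.f (i + 1) x) = x
      rw [hx, map_zero, sub_zero]
    -- The lift is taken through the kernel of `ε`, so that `t` has values there; precomposition
    -- with `ρ` makes the required cycle condition hold on all of `E`.
    obtain ⟨t, ht⟩ := exists_lift_of_forall (hE.projective (i + 1))
      ((kerι ε).f (i + 1 + 1) ≫ E.d (i + 1 + 1) (i + 1)) (ρ ≫ (𝟙 _ - E.d (i + 1) i ≫ s))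
      fun x => by
        change ∃ y : (kerCplx ε).X (i + 1 + 1), E.d _ _ ((kerι ε).f _ y) =
          ρ x - s (E.d (i + 1) i (ρ x))
        obtain ⟨y, hy, hy'⟩ := hker i hi (ρ x - s (E.d (i + 1) i (ρ x)))
          (by rw [map_sub, h2 _ (hρ x), sub_self])
          (by rw [map_sub, hρ, h1 _ (by rw [f_d_apply, hρ, map_zero]), sub_self])
        exact ⟨(⟨y, hy⟩ : LinearMap.ker (ε.f (i + 1 + 1)).hom), hy'⟩
    have ht0 : ∀ x, ε.f (i + 1 + 1) ((kerι ε).f (i + 1 + 1) (t x)) = 0 := fun x =>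
      congr($(kerι_comp ε (i + 1 + 1)) (t x))
    have ht1 : ∀ x, ε.f (i + 1) x = 0 → E.d (i + 1 + 1) (i + 1) ((kerι ε).f (i + 1 + 1) (t x)) =
        x - s (E.d (i + 1) i x) := fun x hx => by
      refine (ht x).trans ?_
      change ρ x - s (E.d (i + 1) i (ρ x)) = _
      rw [hρ' x hx]
    refine ⟨⟨t ≫ (kerι ε).f (i + 1 + 1), fun _ => ⟨fun x _ => ht0 x, fun x hx => ?_⟩⟩,
      fun _ x hx => ⟨rfl, ?_⟩⟩
    · refine (ht1 _ (by rw [f_d_apply, hx, map_zero])).trans ?_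
      rw [d_d_apply, map_zero, sub_zero]
    · change E.d (i + 1 + 1) (i + 1) ((kerι ε).f (i + 1 + 1) (t x)) + s (E.d (i + 1) i x) = x
      rw [ht1 x hx, sub_add_cancel]
  obtain ⟨s, -, hs⟩ := exists_int_family (St := St) r m ⟨s₀, fun _ => ⟨hs₀, hs₀'⟩⟩ hup
    fun i hi s => ⟨⟨0, fun h => by omega⟩, fun h => by omega⟩
  refine hE.exists_of_contraction hP ε hε (m + 1) (fun i => (s i).1)
    (fun i hi => ((s i).2 (by omega)).1) fun j x hj hx => ?_
  obtain ⟨_, e⟩ := hs j (by omega) x hx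
  exact e

theorem coker_π_surjective (X : Cplx R) (n : ℤ) :
    Function.Surjective (cokernel.π (X.d (n + 1) n)) :=
  (ModuleCat.epi_iff_surjective _).1 inferInstance

theorem coker_π_eq_zero_iff (X : Cplx R) (n : ℤ) (x : X.X n) :
    cokernel.π (X.d (n + 1) n) x = 0 ↔ ∃ y, X.d (n + 1) n y = x := by
  refine ⟨fun h => ?_, ?_⟩
  · exact (ShortComplex.moduleCat_exact_iff _).1 (ShortComplex.exact_cokernel (X.d (n + 1) n)) x h
  · rintro ⟨y, rfl⟩
    exact congr($(cokernel.condition (X.d (n + 1) n)) y)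

/-- A map in degree `n` which preserves boundaries extends to a chain map from a totally acyclic
complex to a complex of projective modules that is exact in degrees `> n`. -/
theorem IsTotallyFAcyclic.exists_hom_extending {T P : Cplx R} (hT : IsTotallyFAcyclic T)
    (hP : ∀ i, Module.Projective R (P.X i)) (n : ℤ)
    (hP' : ∀ k, n ≤ k → ExactElt P (k + 1 + 1) (k + 1) k) (σ₀ : T.X n ⟶ P.X n)
    (hσ₀ : ∀ t : T.X (n + 1), ∃ y, P.d (n + 1) n y = σ₀ (T.d (n + 1) n t)) :
    ∃ σ : T ⟶ P, σ.f n = σ₀ := by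
  -- Above `n` the invariant is what a lift needs: `g` sends boundaries to boundaries. Below `n` it
  -- is what an extension needs: `g` followed by `d` kills boundaries. The initial map satisfies
  -- both.
  let St : ℤ → Type u := fun i => {g : T.X i ⟶ P.X i //
    (n ≤ i → ∀ t, ∃ y, P.d (i + 1) i y = g (T.d (i + 1) i t)) ∧
    (i ≤ n → ∀ a b, T.d a i ≫ g ≫ P.d i b = 0)}
  have h0 : ∀ a b, T.d a n ≫ σ₀ ≫ P.d n b = 0 := by
    intro a b
    by_cases ha : n + 1 = a
    · subst ha
      refine ModuleCat.hom_ext (LinearMap.ext fun t => ?_)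
      obtain ⟨y, hy⟩ := hσ₀ t
      change P.d n b (σ₀ (T.d (n + 1) n t)) = 0
      rw [← hy, d_d_apply]
    · rw [T.shape a n (by simpa using ha), zero_comp]
  let r : ∀ i j, St i → St j → Prop := fun i j g h => g.1 ≫ P.d i j = T.d i j ≫ h.1
  have hup : ∀ i, n ≤ i → ∀ x : St i, ∃ y : St (i + 1), r (i + 1) i y x := by
    rintro i hi ⟨g, hg, _⟩
    obtain ⟨h, hh⟩ := exists_lift_of_forall (hT.projective (i + 1)) (P.d (i + 1) i)
      (T.d (i + 1) i ≫ g) (hg hi)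
    refine ⟨⟨h, fun _ t => hP' i hi _ ?_, fun h => by omega⟩,
      ModuleCat.hom_ext (LinearMap.ext hh)⟩
    refine (hh _).trans ?_
    change g (T.d (i + 1) i (T.d (i + 1 + 1) (i + 1) t)) = 0
    rw [d_d_apply, map_zero]
  have hdown : ∀ i, i ≤ n → ∀ x : St i, ∃ y : St (i - 1), r i (i - 1) x y := by
    rintro i hi ⟨g, _, hg⟩
    -- Going down uses exactness of `Hom(T, P_{i-1})`, available since the projective module
    -- `P_{i-1}` is flat.
    obtain ⟨h, hh⟩ := hT.exists_extension (isFlat_of_projective _ (hP (i - 1))) rfl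
      (by omega : i - 1 + 1 = i) (g ≫ P.d i (i - 1)) (hg hi _ _)
    refine ⟨⟨h, fun h => by omega, fun _ a b => ?_⟩, hh.symm⟩
    by_cases ha : i = a
    · subst ha
      rw [← Category.assoc, hh, Category.assoc, P.d_comp_d, comp_zero]
    · rw [T.shape a (i - 1) (by simp; omega), zero_comp]
  obtain ⟨s, hs, hs'⟩ := exists_int_family r n ⟨σ₀, fun _ => hσ₀, fun _ => h0⟩ hup hdown
  refine ⟨{ f := fun i => (s i).1, comm' := ?_ }, congrArg Subtype.val hs⟩
  rintro _ j rfl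
  exact hs' j

/-- If `P` is a complex of projective modules, exact in degrees `> n`, with `C_n(P) ≅ C_n(T)` for
a totally acyclic complex `T`, then some totally acyclic complex maps onto `P`, bijectively in
degrees `≥ n`. -/
theorem IsTotallyFAcyclic.exists_of_coker_iso {T P : Cplx R} (hT : IsTotallyFAcyclic T)
    (hP : ∀ i, Module.Projective R (P.X i)) (m : ℤ)
    (hP' : ∀ k, m + 1 ≤ k → ExactElt P (k + 1 + 1) (k + 1) k)
    (θ : coker T (m + 1) ≅ coker P (m + 1)) :
    ∃ (T' : Cplx R) (τ : T' ⟶ P), IsTotallyFAcyclic T' ∧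
      (∀ i, Function.Surjective (τ.f i)) ∧
      ∀ i, m + 1 ≤ i → Function.Bijective (τ.f i) := by
  obtain ⟨σ₀, h₁⟩ := exists_lift_of_surjective (hT.projective (m + 1))
    (cokernel.π (P.d (m + 1 + 1) (m + 1))) (cokernel.π (T.d (m + 1 + 1) (m + 1)) ≫ θ.hom)
    (coker_π_surjective P _)
  obtain ⟨u, h₂⟩ := exists_lift_of_surjective (hP (m + 1))
    (cokernel.π (T.d (m + 1 + 1) (m + 1))) (cokernel.π (P.d (m + 1 + 1) (m + 1)) ≫ θ.inv)
    (coker_π_surjective T _)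
  have h₁' : ∀ t, cokernel.π (P.d (m + 1 + 1) (m + 1)) (σ₀ t) =
    θ.hom (cokernel.π (T.d (m + 1 + 1) (m + 1)) t) := fun t => congr($h₁ t)
  have h₂' : ∀ p, cokernel.π (T.d (m + 1 + 1) (m + 1)) (u p) =
    θ.inv (cokernel.π (P.d (m + 1 + 1) (m + 1)) p) := fun t => congr($h₂ t)
  have hθ : ∀ x, θ.hom (θ.inv x) = x := fun x => congr($(θ.inv_hom_id) x)
  have hθ' : ∀ x, θ.inv (θ.hom x) = x := fun x => congr($(θ.hom_inv_id) x)
  obtain ⟨σ, rfl⟩ := hT.exists_hom_extending hP (m + 1) hP' σ₀ fun t => by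
    rw [← coker_π_eq_zero_iff, h₁', (coker_π_eq_zero_iff T _ _).2 ⟨t, rfl⟩, map_zero]
  -- As `σ` and `u` induce inverse maps on cokernels, `σu - 1` has values in boundaries, and `β`
  -- lifts it to `P_{m+2}`.
  obtain ⟨β, hβ⟩ := exists_lift_of_forall (hP (m + 1)) (P.d (m + 1 + 1) (m + 1))
    (u ≫ σ.f (m + 1) - 𝟙 _) fun p => by
      rw [← coker_π_eq_zero_iff]
      change cokernel.π (P.d (m + 1 + 1) (m + 1)) (σ.f (m + 1) (u p) - p) = 0
      rw [map_sub, h₁', h₂', hθ, sub_self]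
  have hβ' : ∀ p, P.d (m + 1 + 1) (m + 1) (β p) = σ.f (m + 1) (u p) - p := hβ
  have hu : ∀ t p, T.d (m + 1) m (u (σ.f (m + 1) t + P.d (m + 1 + 1) (m + 1) p)) =
      T.d (m + 1) m t := by
    intro t p
    rw [← sub_eq_zero, ← map_sub]
    obtain ⟨y, hy⟩ := (coker_π_eq_zero_iff T (m + 1)
      (u (σ.f (m + 1) t + P.d (m + 1 + 1) (m + 1) p) - t)).1 (by
        rw [map_sub, h₂', map_add, (coker_π_eq_zero_iff P _ _).2 ⟨p, rfl⟩, add_zero, h₁', hθ',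
          sub_self])
    rw [← hy, d_d_apply]
  -- The initial component is `(t, p, b) ↦ (-u p, β p, σ u p)`. The third entry puts it in the
  -- kernel, and `σu - dβ = 1` recovers the middle coordinate after applying `d`. The outer
  -- coordinates match because `u` inverts `σ` modulo boundaries.
  refine (hT.to_padded hP).exists_of_initial hP (padDesc σ) (padDesc_surjective σ) m hP'
    (ModuleCat.ofHom ((LinearMap.prod (-u.hom) (LinearMap.prod β.hom (u ≫ σ.f (m + 1)).hom)).comp
      ((LinearMap.fst R (P.X (m + 1)) (P.X m)).comp (LinearMap.snd R (T.X m) _))) :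
      ModuleCat.of R (T.X m × P.X (m + 1) × P.X m) ⟶
        ModuleCat.of R (T.X (m + 1) × P.X (m + 1 + 1) × P.X (m + 1))) ?_ ?_
  · intro x _
    obtain ⟨t, p, b, rfl⟩ := padMk_surj x
    change (padDesc σ).f (m + 1) (padMk (-u p) (β p) (σ.f (m + 1) (u p))) = 0
    rw [padDesc_apply, map_neg, neg_add_cancel]
  · intro x hx
    obtain ⟨t, p, b, rfl⟩ := padMk_surj x
    rw [padDesc_apply] at hx
    obtain rfl : b = - σ.f _ t := eq_neg_of_add_eq_zero_right hx
    rw [padded_d]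
    obtain ⟨q, hq⟩ : ∃ q, q = -σ.f (m + 1) t - P.d (m + 1 + 1) (m + 1) p := ⟨_, rfl⟩
    rw [← hq]
    have hq' : T.d (m + 1) m (u q) = - T.d (m + 1) m t := by
      rw [← hu t p, ← map_neg, ← map_neg, hq, neg_add, sub_eq_add_neg]
    refine (padded_d m (-u q) (β q) (σ.f (m + 1) (u q))).trans ?_
    rw [padMk_inj, hβ', ← f_d_apply, map_neg, map_neg, hq', ← f_d_apply, map_neg, neg_neg]
    exact ⟨rfl, by abel, rfl⟩

end Construction

/-! ### Cofibrant resolutions by the small object argument -/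

section Existence

variable {R : Type u} [Ring R]

open MorphismProperty ZeroObject

/-- Relative cell complexes on monomorphisms have monomorphic transition maps. Over a regular
cardinal exceeding the number of subobjects of each source, maps out of that source commute with
such colimits. -/
instance hasSmallObjectArgument_of_mono {C : Type*} [Category* C] [Abelian C]
    [IsGrothendieckAbelian.{u} C] {ι : Type} [Small.{u} ι] {A B : ι → C} (f : ∀ i, A i ⟶ B i)
    [∀ i, Mono (f i)] : HasSmallObjectArgument.{u} (ofHoms f) := by
  obtain ⟨κ, hκ', hκ⟩ := HasCardinalLT.exists_regular_cardinal_forall.{u}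
    (fun i => Subobject (A i))
  have : Fact κ.IsRegular := ⟨hκ'⟩
  have : Nonempty κ.ord.ToType := by simpa using hκ'.ne_zero
  have := WellFoundedLT.toOrderBot κ.ord.ToType
  have hmono : ofHoms f ≤ monomorphisms C := by
    rintro _ _ _ ⟨i⟩
    exact inferInstanceAs (Mono (f i))
  exact ⟨κ, inferInstance, inferInstance,
    { preservesColimit {A' B' X Y} i hi g hg := by
        let hg' : (monomorphisms C).TransfiniteCompositionOfShape κ.ord.ToType g :=
          { toTransfiniteCompositionOfShape := hg.toTransfiniteCompositionOfShape
            map_mem j hj := by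
              have := (hg.attachCells j hj).pushouts_coproducts
              simp only [ofHoms_homFamily] at this
              refine (?_ : _ ≤ monomorphisms C) _ this
              simp only [pushouts_le_iff, coproducts_le_iff]
              exact hmono }
        have (j j' : κ.ord.ToType) (φ : j ⟶ j') : Mono (hg'.F.map φ) := hg'.mem_map φ
        apply IsGrothendieckAbelian.preservesColimit_coyoneda_obj_of_mono (Y := hg'.F) (κ := κ)
        obtain ⟨i⟩ := hi
        exact hκ i }⟩

theorem down_rel (m : ℤ) : (ComplexShape.down ℤ).Rel (m + 1) m := rfl

/-- The disk complex, given by the identity of `R` in degrees `m + 1` and `m`. -/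
noncomputable abbrev disk (R : Type u) [Ring R] (m : ℤ) : Cplx R :=
  HomologicalComplex.double (c := ComplexShape.down ℤ) (i₀ := m + 1) (i₁ := m)
    (𝟙 (ModuleCat.of R R)) (down_rel m)

/-- The sphere complex, given by `R` in degree `m`. -/
noncomputable abbrev sphere (R : Type u) [Ring R] (m : ℤ) : Cplx R :=
  (HomologicalComplex.single (ModuleCat.{u} R) (ComplexShape.down ℤ) m).obj (ModuleCat.of R R)

/-- The inclusion of the sphere as the boundary of the disk. -/
noncomputable def sphereToDisk (R : Type u) [Ring R] (m : ℤ) : sphere R m ⟶ disk R m :=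
  HomologicalComplex.mkHomFromSingle
    (HomologicalComplex.doubleXIso₁ (c := ComplexShape.down ℤ) (i₀ := m + 1) (i₁ := m)
      (𝟙 (ModuleCat.of R R)) (down_rel m) (by omega)).inv
    fun k _ => by
      rw [HomologicalComplex.double_d_eq_zero₀ _ (down_rel m) _ _ (show m ≠ m + 1 by omega),
        comp_zero]

instance (m : ℤ) : Mono (sphereToDisk R m) := by
  have : ∀ i, Mono ((sphereToDisk R m).f i) := fun i => by
    by_cases hi : i = m
    · subst hi
      rw [sphereToDisk, HomologicalComplex.mkHomFromSingle_f]
      infer_instance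
    · exact ⟨fun _ _ _ => (HomologicalComplex.isZero_single_obj_X _ m _ i hi).eq_of_tgt _ _⟩
  exact HomologicalComplex.mono_of_mono_f _ this

/-- The map from `R` given by an element. -/
def fromRing {M : ModuleCat.{u} R} (x : M) : ModuleCat.of R R ⟶ M :=
  ModuleCat.ofHom (LinearMap.toSpanSingleton R M x)

theorem fromRing_ext {M : ModuleCat.{u} R} {f g : ModuleCat.of R R ⟶ M}
    (h : f (1 : R) = g (1 : R)) : f = g :=
  ModuleCat.hom_ext (LinearMap.ext_ring h)

theorem fromRing_one {M : ModuleCat.{u} R} (x : M) : fromRing x (1 : R) = x :=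
  LinearMap.toSpanSingleton_apply_one R M x

theorem fromRing_comp {M N : ModuleCat.{u} R} (x : M) (f : M ⟶ N) :
    fromRing x ≫ f = fromRing (f x) :=
  fromRing_ext ((congrArg f (fromRing_one x)).trans (fromRing_one _).symm)

theorem exists_eq_fromRing {M : ModuleCat.{u} R} (f : ModuleCat.of R R ⟶ M) :
    ∃ x, f = fromRing x := ⟨f (1 : R), fromRing_ext (fromRing_one _).symm⟩

theorem fromRing_inj {M : ModuleCat.{u} R} {x y : M} : fromRing x = fromRing y ↔ x = y :=
  ⟨fun h => (fromRing_one x).symm.trans (congr($h (1 : R)).trans (fromRing_one y)),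
    fun h => h ▸ rfl⟩

theorem fromRing_zero {M : ModuleCat.{u} R} : fromRing (0 : M) = 0 :=
  fromRing_ext (fromRing_one _)

/-- The chain map from the disk given by an element of degree `m + 1`. -/
theorem exists_hom_disk {E : Cplx R} {m : ℤ} (z : E.X (m + 1)) :
    ∃ l : disk R m ⟶ E,
      l.f (m + 1) = (HomologicalComplex.doubleXIso₀ _ _).hom ≫ fromRing z ∧
      l.f m = (HomologicalComplex.doubleXIso₁ _ _ (by omega)).hom ≫
        fromRing (E.d (m + 1) m z) := by
  refine ⟨HomologicalComplex.mkHomFromDouble _ (by omega) (fromRing z)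
    (fromRing (E.d (m + 1) m z)) ?_ ?_, ?_, ?_⟩
  · rw [fromRing_comp, Category.id_comp]
  · intro k _
    rw [fromRing_comp, d_d_apply, fromRing_zero]
  · exact HomologicalComplex.mkHomFromDouble_f₀ _ _ _ _ _ _
  · exact HomologicalComplex.mkHomFromDouble_f₁ _ _ _ _ _ _

/-- A map from the sphere is a cycle in degree `m`, and one from the disk is an element in degree `m
+ 1`; the lifting problem thus becomes a statement about elements. -/
theorem hasLiftingProperty_sphereToDisk {E B : Cplx R} (p : E ⟶ B) (m : ℤ)
    (h : ∀ (x : E.X m) (y : B.X (m + 1)), (∀ k, E.d m k x = 0) → B.d (m + 1) m y = p.f m x →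
      ∃ z, E.d (m + 1) m z = x ∧ p.f (m + 1) z = y) :
    HasLiftingProperty (sphereToDisk R m) p where
  sq_hasLift {t b} sq := by
    obtain ⟨x, hx⟩ := exists_eq_fromRing
      ((HomologicalComplex.singleObjXSelf (ComplexShape.down ℤ) m (ModuleCat.of R R)).inv ≫ t.f m)
    obtain ⟨y, hy⟩ := exists_eq_fromRing ((HomologicalComplex.doubleXIso₀ _ _).inv ≫ b.f (m + 1))
    rw [Iso.inv_comp_eq] at hx hy
    have hdx : ∀ k, E.d m k x = 0 := fun k => by
      have h1 : t.f m ≫ E.d m k = 0 := by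
        rw [t.comm, HomologicalComplex.single_obj_d, zero_comp]
      rw [hx, Category.assoc, fromRing_comp] at h1
      apply fromRing_inj.1
      rw [fromRing_zero, ← cancel_epi (HomologicalComplex.singleObjXSelf _ m _).hom, h1, comp_zero]
    have hb : b.f m = (HomologicalComplex.doubleXIso₁ _ _ (by omega)).hom ≫
        fromRing (B.d (m + 1) m y) := by
      have h1 := b.comm (m + 1) m
      rw [hy, HomologicalComplex.double_d _ (down_rel m) (by omega), Category.assoc, fromRing_comp,
        Category.id_comp, Category.assoc] at h1
      rw [← Iso.inv_comp_eq]
      exact ((cancel_epi _).1 h1).symm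
    have hyx : B.d (m + 1) m y = p.f m x := by
      have h1 := congr(($(sq.w)).f m)
      rw [HomologicalComplex.comp_f, HomologicalComplex.comp_f, hx, hb, sphereToDisk,
        HomologicalComplex.mkHomFromSingle_f, Category.assoc, Category.assoc,
        Iso.inv_hom_id_assoc, fromRing_comp] at h1
      exact (fromRing_inj.1 ((cancel_epi _).1 h1)).symm
    obtain ⟨z, hz, hz'⟩ := h x y hdx hyx
    obtain ⟨l, hl, hl'⟩ := exists_hom_disk z
    refine ⟨⟨⟨l, ?_, ?_⟩⟩⟩
    · apply HomologicalComplex.from_single_hom_ext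
      rw [HomologicalComplex.comp_f, hl', hx, hz, sphereToDisk,
        HomologicalComplex.mkHomFromSingle_f, Category.assoc, Iso.inv_hom_id_assoc]
    · apply HomologicalComplex.from_double_hom_ext
      · rw [HomologicalComplex.comp_f, hl, hy, Category.assoc, fromRing_comp, hz']
      · rw [HomologicalComplex.comp_f, hl', hb, Category.assoc, fromRing_comp, hz, hyx]

theorem exists_of_hasLiftingProperty {E B : Cplx R} (p : E ⟶ B) (m : ℤ)
    (h : HasLiftingProperty (sphereToDisk R m) p) (x : E.X m) (y : B.X (m + 1))
    (hx : ∀ k, E.d m k x = 0) (hy : B.d (m + 1) m y = p.f m x) :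
    ∃ z, E.d (m + 1) m z = x ∧ p.f (m + 1) z = y := by
  let t : sphere R m ⟶ E := HomologicalComplex.mkHomFromSingle (fromRing x) fun k _ => by
    rw [fromRing_comp, hx, fromRing_zero]
  have ht : t.f m = (HomologicalComplex.singleObjXSelf _ m _).hom ≫ fromRing x :=
    HomologicalComplex.mkHomFromSingle_f _ _
  obtain ⟨b, hb, hb'⟩ := exists_hom_disk y
  have sq : CommSq t (sphereToDisk R m) p b := ⟨by
    apply HomologicalComplex.from_single_hom_ext
    rw [HomologicalComplex.comp_f, HomologicalComplex.comp_f, ht, hb', sphereToDisk,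
        HomologicalComplex.mkHomFromSingle_f, Category.assoc, Category.assoc,
        Iso.inv_hom_id_assoc, fromRing_comp, hy]⟩
  obtain ⟨⟨l, hl, hl'⟩⟩ := h.sq_hasLift sq
  obtain ⟨z, hz⟩ := exists_eq_fromRing ((HomologicalComplex.doubleXIso₀ _ _).inv ≫ l.f (m + 1))
  rw [Iso.inv_comp_eq] at hz
  have hlm : l.f m = (HomologicalComplex.doubleXIso₁ _ _ (by omega)).hom ≫
      fromRing (E.d (m + 1) m z) := by
    have h1 := l.comm (m + 1) m
    rw [hz, HomologicalComplex.double_d _ (down_rel m) (by omega), Category.assoc, fromRing_comp,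
      Category.id_comp, Category.assoc] at h1
    rw [← Iso.inv_comp_eq]
    exact ((cancel_epi _).1 h1).symm
  refine ⟨z, ?_, ?_⟩
  · have h1 := congr(($hl).f m)
    rw [HomologicalComplex.comp_f, hlm, ht, sphereToDisk, HomologicalComplex.mkHomFromSingle_f,
      Category.assoc, Iso.inv_hom_id_assoc] at h1
    exact fromRing_inj.1 ((cancel_epi _).1 h1)
  · have h1 := congr(($hl').f (m + 1))
    rw [HomologicalComplex.comp_f, hz, hb, Category.assoc, fromRing_comp] at h1
    exact fromRing_inj.1 ((cancel_epi _).1 h1)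

/-- Every complex receives a surjective quasi-isomorphism from a complex with the lifting property
with respect to all surjective quasi-isomorphisms. -/
theorem exists_cofibrant_resolution (X : Cplx R) :
    ∃ (P : Cplx R) (π : P ⟶ X), QuasiIso π ∧
      ∀ (E B : Cplx R) (p : E ⟶ B), (∀ i, Function.Surjective (p.f i)) → KerExact p →
        ∀ b : P ⟶ B, ∃ l : P ⟶ E, l ≫ p = b := by
  let I : MorphismProperty (Cplx R) := ofHoms (sphereToDisk R)
  obtain ⟨P, i, π, _, hi, hπ⟩ := factorizationData I.rlp.llp I.rlp (0 : (0 : Cplx R) ⟶ X)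
  have H := fun m => exists_of_hasLiftingProperty π m (hπ _ ⟨m⟩)
  refine ⟨P, π, quasiIso_of_kerExact π (fun k y => ?_) ?_, fun E B p hs hk b => ?_⟩
  · obtain ⟨m, rfl⟩ : ∃ m, k = m + 1 + 1 := ⟨k - 1 - 1, by omega⟩
    -- Surjectivity takes two lifts: first the cycle `d y` is lifted to a cycle `x`, then `y` itself
    -- to an element with boundary `x`.
    obtain ⟨x, hx, hx'⟩ := H m 0 (X.d (m + 1 + 1) (m + 1) y) (fun k => map_zero _)
      (by rw [d_d_apply, map_zero])
    obtain ⟨z, -, hz⟩ := H (m + 1) x y (fun k => by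
      by_cases hk : k = m
      · subst hk
        exact hx
      · rw [P.shape _ _ (by simp; omega)]
        rfl) hx'.symm
    exact ⟨z, hz⟩
  · rintro _ _ k rfl rfl x hx hx'
    obtain ⟨z, hz, hz'⟩ := H (k + 1) x 0 (fun j => by
      by_cases hj : j = k
      · subst hj
        exact hx
      · rw [P.shape _ _ (by simp; omega)]
        rfl) (by rw [hx', map_zero])
    exact ⟨z, hz', hz⟩
  · have hp : I.rlp p := by
      rintro _ _ _ ⟨m⟩
      refine hasLiftingProperty_sphereToDisk p m fun x y hx hy => ?_
      obtain ⟨z₀, rfl⟩ := hs _ y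
      obtain ⟨w, hw, hw'⟩ := hk (m + 1) m (m - 1) rfl (by omega) (x - E.d (m + 1) m z₀)
        (by rw [map_sub, hx, d_d_apply, sub_zero]) (by rw [map_sub, f_d_apply, hy, sub_self])
      exact ⟨z₀ + w, by rw [map_add, hw']; abel, by rw [map_add, hw, add_zero]⟩
    have sq : CommSq (0 : (0 : Cplx R) ⟶ E) i p b := ⟨(isZero_zero _).eq_of_src _ _⟩
    obtain ⟨⟨l, _, hl⟩⟩ := (hi p hp).sq_hasLift sq
    exact ⟨l, hl⟩

end Existence

/-! ### Cofibrant complexes are DG-projective -/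

section Cofibrant

variable {R : Type u} [Ring R]

/-- The chain map `padded A B ⟶ padded A B'` induced by a chain map `B ⟶ B'`. -/
def padMapRight (A : Cplx R) {B B' : Cplx R} (g : B ⟶ B') : padded A B ⟶ padded A B' where
  f i := ModuleCat.ofHom ((LinearMap.id : A.X i →ₗ[R] _).prodMap
    ((g.f (i + 1)).hom.prodMap (g.f i).hom))
  comm' := hom_ext_of_succ _ fun j p => by
    obtain ⟨a, x, b, rfl⟩ := padMk_surj p
    change _ = (padded A B').d _ _ (padMk a (g.f _ x) (g.f _ b))
    rw [padded_d, padded_d, ← f_d_apply, ← f_d_apply, ← map_sub]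
    rfl

theorem padMapRight_apply (A : Cplx R) {B B' : Cplx R} (g : B ⟶ B') {i : ℤ} (a : A.X i)
    (x : B.X (i + 1)) (b : B.X i) :
    (padMapRight A g).f i (padMk a x b) = padMk a (g.f _ x) (g.f _ b) := rfl

theorem padMapRight_surjective (A : Cplx R) {B B' : Cplx R} (g : B ⟶ B')
    (hg : ∀ i, Function.Surjective (g.f i)) (i : ℤ) :
    Function.Surjective ((padMapRight A g).f i) := fun p => by
  obtain ⟨a, x, b, rfl⟩ := padMk_surj p
  obtain ⟨x, rfl⟩ := hg _ x
  obtain ⟨b, rfl⟩ := hg _ b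
  exact ⟨padMk a x b, padMapRight_apply A g a x b⟩

/-- The kernel is the contractible complex on the kernel of `g`, whatever `g` is. -/
theorem padMapRight_kerExact (A : Cplx R) {B B' : Cplx R} (g : B ⟶ B') :
    KerExact (padMapRight A g) := by
  rintro _ _ k rfl rfl p hp hp'
  obtain ⟨a, x, b, rfl⟩ := padMk_surj p
  rw [padded_d, padMk_zero, padMk_inj] at hp
  rw [padMapRight_apply, padMk_zero, padMk_inj] at hp'
  obtain ⟨rfl, hx, hb⟩ := hp'
  refine ⟨padMk 0 0 x, ?_, ?_⟩
  · rw [padMapRight_apply, hx, map_zero]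
    rfl
  · rw [padded_d, padMk_inj, map_zero, map_zero, sub_zero, ← sub_eq_zero.1 hp.2.1]
    exact ⟨rfl, rfl, rfl⟩

/-- The second component of `padded A B`. -/
def padMid (A B : Cplx R) (i : ℤ) : (padded A B).X i ⟶ B.X (i + 1) :=
  (ModuleCat.ofHom ((LinearMap.fst R (B.X (i + 1)) (B.X i)).comp
    (LinearMap.snd R (A.X i) (B.X (i + 1) × B.X i))) :
      ModuleCat.of R (A.X i × B.X (i + 1) × B.X i) ⟶ B.X (i + 1))

theorem padMid_apply {A B : Cplx R} {i : ℤ} (a : A.X i) (x : B.X (i + 1)) (b : B.X i) :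
    padMid A B i (padMk a x b) = x := rfl

/-- The complex with the same module in each degree and zero differential. -/
def constCplx (M : ModuleCat.{u} R) : Cplx R where
  X _ := M
  d _ _ := 0

/-- The chain map to a contractible complex given by a family of homomorphisms. -/
def homPaddedConst (P : Cplx R) {M : ModuleCat.{u} R} (h : ∀ i, P.X i ⟶ M) :
    P ⟶ padded P (constCplx M) where
  f i := (ModuleCat.ofHom ((0 : P.X i →ₗ[R] P.X i).prod
    ((h i).hom.prod (P.d i (i - 1) ≫ h (i - 1)).hom)) :
      P.X i ⟶ ModuleCat.of R (P.X i × M × M))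
  comm' := hom_ext_of_succ _ fun j x => by
    have key : ∀ m, m = j → h m (P.d (j + 1) m x) = h j (P.d (j + 1) j x) := by
      rintro _ rfl
      rfl
    change (padMk 0 (h j (P.d (j + 1) j x)) (h (j - 1) (P.d j (j - 1) (P.d (j + 1) j x))) :
      (padded P (constCplx M)).X j) = _
    refine Eq.trans (padMk_inj.2 ⟨?_, ?_, ?_⟩) (padded_d (A := P) (B := constCplx M) j 0
      (h (j + 1) x) (h (j + 1 - 1) (P.d (j + 1) (j + 1 - 1) x))).symm
    · exact (map_zero _).symm
    · exact (key _ (by omega)).symm.trans (sub_zero _).symm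
    · exact (congrArg (h (j - 1)) (d_d_apply P _ _ _ x)).trans (map_zero _)

theorem homPaddedConst_mid (P : Cplx R) {M : ModuleCat.{u} R} (h : ∀ i, P.X i ⟶ M) (i : ℤ)
    (x : P.X i) : padMid P (constCplx M) i ((homPaddedConst P h).f i x) = h i x := rfl

/-- The lifting property of a complex with respect to surjective quasi-isomorphisms. -/
def IsCofibrant (P : Cplx R) : Prop :=
  ∀ (E B : Cplx R) (p : E ⟶ B), (∀ i, Function.Surjective (p.f i)) → KerExact p →
    ∀ b : P ⟶ B, ∃ l : P ⟶ E, l ≫ p = b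

/-- Any family of maps `P_j → M` is the middle coordinate of a chain map into a contractible
complex. Lifting the family that is the identity at `i` and zero elsewhere splits the free cover of
`P_i`. -/
theorem IsCofibrant.projective {P : Cplx R} (hP : IsCofibrant P) (i : ℤ) :
    Module.Projective R (P.X i) := by
  refine Module.Projective.of_lifting_property'' fun f hf => ?_
  let g : constCplx (ModuleCat.of R (P.X i →₀ R)) ⟶ constCplx (P.X i) :=
    { f := fun _ => ModuleCat.ofHom f
      comm' := fun _ _ _ => comp_zero.trans zero_comp.symm }
  let h : ∀ j, P.X j ⟶ P.X i := fun j => if e : j = i then eqToHom (by rw [e]) else 0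
  have hi : h i = 𝟙 _ := dif_pos rfl
  obtain ⟨l, hl⟩ := hP _ _ (padMapRight P g) (padMapRight_surjective P g fun _ => hf)
    (padMapRight_kerExact P g) (homPaddedConst P h)
  refine ⟨(l.f i ≫ padMid P _ i).hom, LinearMap.ext fun x => ?_⟩
  have h1 : padMid P (constCplx (P.X i)) i ((padMapRight P g).f i (l.f i x)) = x := by
    rw [← ConcreteCategory.comp_apply (l.f i), ← HomologicalComplex.comp_f, hl,
      homPaddedConst_mid, hi]
    rfl
  exact h1

/-- As `Y` is acyclic, `0 : Y ⟶ Y` is a quasi-isomorphism, so `padDesc 0` is a surjection with exact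
kernel. The middle coordinate of a lift of `u` is the null-homotopy. -/
theorem IsCofibrant.exists_nullHomotopy {P Y : Cplx R} (hP : IsCofibrant P) (hY : Y.Acyclic)
    (u : P ⟶ Y) : ∃ k : ∀ i, P.X i ⟶ Y.X (i + 1), ∀ j,
      u.f (j + 1) = k (j + 1) ≫ Y.d (j + 1 + 1) (j + 1) + P.d (j + 1) j ≫ k j := by
  rw [acyclic_iff_exactElt] at hY
  have h0 : QuasiIso (0 : Y ⟶ Y) := by
    rw [quasiIso_iff_qisoElt]
    exact fun i j k hij hjk => ⟨fun x hx _ => hY i j k hij hjk x hx, fun y hy =>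
      ⟨0, map_zero _, (hY i j k hij hjk y hy).imp fun w hw => by rw [hw, map_zero, zero_add]⟩⟩
  obtain ⟨l, hl⟩ := hP _ _ (padDesc (0 : Y ⟶ Y)) (padDesc_surjective _) (padDesc_kerExact _ h0) u
  refine ⟨fun i => l.f i ≫ padMid Y Y i, fun j => ModuleCat.hom_ext (LinearMap.ext fun x => ?_)⟩
  have h1 : (padDesc (0 : Y ⟶ Y)).f (j + 1) (l.f (j + 1) x) = u.f (j + 1) x :=
    congr(($hl).f (j + 1) x)
  have h2 := f_d_apply l (j + 1) j x
  obtain ⟨a, y, b, hb⟩ := padMk_surj (l.f (j + 1) x)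
  rw [hb, padDesc_apply] at h1
  rw [hb, padded_d] at h2
  change u.f (j + 1) x = Y.d _ _ (padMid Y Y (j + 1) (l.f (j + 1) x)) +
    padMid Y Y j (l.f j (P.d (j + 1) j x))
  rw [hb, h2, padMid_apply, padMid_apply, ← h1]
  change 0 + b = _
  abel

/-- The shift of a complex, without sign. -/
def shift (X : Cplx R) (n : ℤ) : Cplx R where
  X i := X.X (i + n)
  d i j := X.d (i + n) (j + n)
  shape i j h := X.shape _ _ fun h' => h (by
    have h' : j + n + 1 = i + n := h'
    change j + 1 = i
    omega)

theorem shift_acyclic {X : Cplx R} (h : X.Acyclic) (n : ℤ) : (shift X n).Acyclic := by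
  rw [acyclic_iff_exactElt] at h ⊢
  exact fun i j k hij hjk => h (i + n) (j + n) (k + n) (by omega) (by omega)

theorem homDiff_homDiff (P Y : Cplx R) (n : ℤ) (g : HomDeg P Y (n + 1)) :
    homDiff P Y n (n - 1) (by omega) (homDiff P Y (n + 1) n rfl g) = 0 := by
  funext ⟨⟨i, j⟩, h⟩
  simp only [homDiff, Preadditive.sub_comp, Preadditive.comp_sub, Category.assoc,
    Int.negOnePow_succ, HomologicalComplex.d_comp_d, comp_zero, Units.neg_smul]
  simp

theorem IsCofibrant.isDGProjective {P : Cplx R} (hP : IsCofibrant P) : IsDGProjective P := by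
  refine ⟨hP.projective, fun Y hY n f => ⟨fun hf => ?_, ?_⟩⟩
  · let F : ∀ i, P.X i ⟶ Y.X (i + n) := fun i => f ⟨(i, i + n), rfl⟩
    have hF : ∀ j, F (j + 1) ≫ Y.d (j + 1 + n) (j + n) =
        n.negOnePow • (P.d (j + 1) j ≫ F j) := fun j => by
      have e1 : ∀ q (h : j + 1 + n = q), f ⟨(j + 1, q), h⟩ ≫ Y.d q (j + n) =
          F (j + 1) ≫ Y.d (j + 1 + n) (j + n) := by
        rintro _ rfl
        rfl
      have e2 : ∀ m (h : m + n = j + n), m = j → P.d (j + 1) m ≫ f ⟨(m, j + n), h⟩ =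
          P.d (j + 1) j ≫ F j := by
        rintro _ _ rfl
        rfl
      have h := congrFun hf ⟨(j + 1, j + n), by dsimp only; omega⟩
      rw [← e1 (j + n + 1) (by omega), ← e2 (j + 1 - 1) (by omega) (by omega)]
      exact sub_eq_zero.1 h
    -- Rescaling by `(-1)^(n i)` turns a cocycle of degree `n` into a chain map to the shift taken
    -- without sign; the same signs turn its null-homotopy back into a cochain `g`.
    let σ : ℤ → ℤˣ := fun i => (n * i).negOnePow
    have hσ : ∀ j, σ (j + 1) = σ j * n.negOnePow := fun j => by
      rw [← Int.negOnePow_add]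
      exact congrArg Int.negOnePow (by ring)
    have hσσ : ∀ j, σ j * σ j = 1 := fun j => Int.units_mul_self _
    have hn : n.negOnePow * n.negOnePow = 1 := Int.units_mul_self _
    let v : ∀ i, P.X i ⟶ Y.X (i + n) := fun i => σ i • F i
    have hv : ∀ j, v (j + 1) ≫ Y.d (j + 1 + n) (j + n) = P.d (j + 1) j ≫ v j := fun j => by
      rw [Linear.units_smul_comp, Linear.comp_units_smul, hF, smul_smul, hσ, mul_assoc, hn,
        mul_one]
    obtain ⟨k, hk⟩ := hP.exists_nullHomotopy (shift_acyclic hY n) (u :=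
      { f := v
        comm' := by
          rintro _ j rfl
          exact hv j })
    let K : ∀ i, P.X i ⟶ Y.X (i + 1 + n) := k
    have hk' : ∀ j, v (j + 1) = K (j + 1) ≫ Y.d (j + 1 + 1 + n) (j + 1 + n) +
        P.d (j + 1) j ≫ K j := hk
    let g : HomDeg P Y (n + 1) := fun p => σ p.1.1 • (K p.1.1 ≫
      (Y.XIsoOfEq (show p.1.1 + 1 + n = p.1.2 by rw [← p.2]; ring)).hom)
    refine ⟨g, funext ?_⟩
    rintro ⟨⟨i, b⟩, h⟩
    obtain ⟨j, rfl⟩ : ∃ j, i = j + 1 := ⟨i - 1, by omega⟩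
    obtain rfl : j + 1 + n = b := h
    have e1 : g ⟨(j + 1, j + 1 + n + 1), by ring⟩ ≫ Y.d (j + 1 + n + 1) (j + 1 + n) =
        σ (j + 1) • (K (j + 1) ≫ Y.d (j + 1 + 1 + n) (j + 1 + n)) := by
      rw [Linear.units_smul_comp, Category.assoc, HomologicalComplex.XIsoOfEq_hom_comp_d]
    have e2 : ∀ m (h : m + (n + 1) = j + 1 + n), m = j →
        P.d (j + 1) m ≫ g ⟨(m, j + 1 + n), h⟩ = σ j • (P.d (j + 1) j ≫ K j) := by
      rintro _ _ rfl
      rw [Linear.comp_units_smul, HomologicalComplex.XIsoOfEq_rfl, Iso.refl_hom, Category.comp_id]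
    refine (congrArg₂ (· - (n + 1).negOnePow • ·) e1 (e2 (j + 1 - 1) _
      (by omega))).trans ?_
    change σ (j + 1) • _ - (n + 1).negOnePow • (σ j • _) = F (j + 1)
    have h1 : F (j + 1) = σ (j + 1) • v (j + 1) := by rw [smul_smul, hσσ, one_smul]
    rw [h1, hk', smul_add, Int.negOnePow_succ, Units.neg_smul, sub_neg_eq_add, smul_smul, hσ,
      mul_comm n.negOnePow]
  · rintro ⟨g, rfl⟩
    exact homDiff_homDiff P Y n g

theorem exists_isDGProjectiveResolution (X : Cplx R) :
    ∃ (P : Cplx R) (π : P ⟶ X), IsDGProjectiveResolution π := by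
  obtain ⟨P, π, h, hP⟩ := exists_cofibrant_resolution X
  exact ⟨P, π, IsCofibrant.isDGProjective hP, h⟩

end Cofibrant

/-! ### Shifts, cokernels and bounds on the two dimensions -/

section Dimension

variable {R : Type u} [Ring R]

theorem IsTotallyFAcyclic.shift {T : Cplx R} (hT : IsTotallyFAcyclic T) (n : ℤ) :
    IsTotallyFAcyclic (shift T n) := by
  refine .of_extension (fun i => hT.projective (i + n)) (shift_acyclic hT.exact n)
    fun F hF k g hg => ?_
  exact hT.exists_extension hF (i := k + 1 + 1 + n) (j := k + 1 + n) (k := k + n) (by ring)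
    (by ring) g hg

/-- The cokernel of the shifted complex. -/
noncomputable def cokerShiftIso (X : Cplx R) (n m k : ℤ) (h : m + n = k) :
    coker (shift X n) m ≅ coker X k :=
  cokernel.mapIso ((shift X n).d (m + 1) m) (X.d (k + 1) k)
    (X.XIsoOfEq (show m + 1 + n = k + 1 by omega)) (X.XIsoOfEq h)
    ((HomologicalComplex.d_comp_XIsoOfEq_hom X h (m + 1 + n)).trans
      (HomologicalComplex.XIsoOfEq_hom_comp_d X _ k).symm)

theorem IsTotallyFAcyclic.isDingProjective_of_iso {T : Cplx R} (hT : IsTotallyFAcyclic T) (n : ℤ)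
    {M : ModuleCat.{u} R} (e : coker T n ≅ M) : IsDingProjective M :=
  ⟨_, hT.shift n, ⟨cokerShiftIso T n 0 n (zero_add n) ≪≫ e⟩⟩

theorem IsDingProjective.exists_coker_iso {M : ModuleCat.{u} R} (hM : IsDingProjective M) (n : ℤ) :
    ∃ T : Cplx R, IsTotallyFAcyclic T ∧ Nonempty (coker T n ≅ M) := by
  obtain ⟨T, hT, ⟨e⟩⟩ := hM
  exact ⟨_, hT.shift (-n), ⟨cokerShiftIso T (-n) n 0 (add_neg_cancel n) ≪≫ e⟩⟩

theorem nonempty_coker_iso {T P : Cplx R} (τ : T ⟶ P) (n : ℤ)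
    (h : ∀ i, n ≤ i → Function.Bijective (τ.f i)) : Nonempty (coker T n ≅ coker P n) := by
  have h0 := (ConcreteCategory.isIso_iff_bijective _).2 (h n le_rfl)
  have h1 := (ConcreteCategory.isIso_iff_bijective _).2 (h (n + 1) (by omega))
  exact ⟨cokernel.mapIso _ _ (asIso (τ.f (n + 1))) (asIso (τ.f n)) (τ.comm _ _).symm⟩

theorem supH_le_iff (X : Cplx R) (n : ℤ) :
    supH X ≤ ((n : WithTop ℤ) : WithBot (WithTop ℤ)) ↔
      ∀ k, n ≤ k → ExactElt X (k + 1 + 1) (k + 1) k := by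
  have h : ∀ k, ExactElt X (k + 1 + 1) (k + 1) k ↔ IsZero (X.homology (k + 1)) := fun k => by
    rw [← exactAt_iff_exactElt X _ _ _ rfl rfl, HomologicalComplex.exactAt_iff_isZero_homology]
  rw [supH, sSup_le_iff]
  refine ⟨fun H k hk => (h k).2 ?_, ?_⟩
  · by_contra hk'
    have := H _ ⟨k + 1, hk', rfl⟩
    rw [WithBot.coe_le_coe, WithTop.coe_le_coe] at this
    omega
  · rintro H _ ⟨i, hi, rfl⟩
    rw [WithBot.coe_le_coe, WithTop.coe_le_coe]
    by_contra hn
    have := (h (i - 1)).1 (H (i - 1) (by omega))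
    rw [sub_add_cancel] at this
    exact hi this

/-- The admissible integers are closed upwards. If `n` were not admissible, all of them would be `≥
n + 1`, and so would the infimum. -/
theorem dpd_le_iff (X : Cplx R) (n : ℤ) :
    Dpd X ≤ ((n : WithTop ℤ) : WithBot (WithTop ℤ)) ↔
      ∃ (T P : Cplx R) (τ : T ⟶ P) (π : P ⟶ X),
        IsFCompleteResolution τ π ∧ ∀ i, n ≤ i → Function.Bijective (τ.f i) := by
  refine ⟨fun h => ?_, fun h => sInf_le ⟨n, rfl, h⟩⟩
  by_contra H
  have h1 : (((n + 1 : ℤ) : WithTop ℤ) : WithBot (WithTop ℤ)) ≤ Dpd X := by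
    refine le_sInf ?_
    rintro _ ⟨m, rfl, T, P, τ, π, hτ, hb⟩
    rw [WithBot.coe_le_coe, WithTop.coe_le_coe]
    by_contra hm
    exact H ⟨T, P, τ, π, hτ, fun i hi => hb i (by omega)⟩
  have h2 := h1.trans h
  rw [WithBot.coe_le_coe, WithTop.coe_le_coe] at h2
  omega

theorem exactElt_iff_of_quasiIso {P X : Cplx R} (π : P ⟶ X) (hπ : QuasiIso π) (k : ℤ) :
    ExactElt P (k + 1 + 1) (k + 1) k ↔ ExactElt X (k + 1 + 1) (k + 1) k := by
  rw [← exactAt_iff_exactElt P _ _ _ rfl rfl, ← exactAt_iff_exactElt X _ _ _ rfl rfl]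
  exact exactAt_iff_of_quasiIsoAt π (k + 1)

theorem exactElt_of_bijective {T P : Cplx R} (τ : T ⟶ P) (hT : T.Acyclic) (n : ℤ)
    (h : ∀ i, n ≤ i → Function.Bijective (τ.f i)) (k : ℤ) (hk : n ≤ k) :
    ExactElt P (k + 1 + 1) (k + 1) k := fun x hx => by
  obtain ⟨t, rfl⟩ := (h (k + 1) (by omega)).2 x
  obtain ⟨s, rfl⟩ := (acyclic_iff_exactElt T).1 hT _ _ _ rfl rfl t
    ((h k hk).1 (by rw [f_d_apply, hx, map_zero]))
  exact ⟨τ.f _ s, (f_d_apply τ _ _ s).symm⟩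

theorem bijective_eqToHom {M N : ModuleCat.{u} R} {f : M ⟶ N} (h : ∃ h : M = N, f = eqToHom h) :
    Function.Bijective f := by
  obtain ⟨h, rfl⟩ := h
  exact (ConcreteCategory.isIso_iff_bijective _).1 inferInstance

end Dimension
end DingDim

/-! ### The equivalence -/

theorem mainTheorem1 (R : Type u) [Ring R] (X : DingDim.Cplx R) (n : ℤ) :
    List.TFAE [
      DingDim.Dpd X ≤ ((n : WithTop ℤ) : WithBot (WithTop ℤ)),
      DingDim.supH X ≤ ((n : WithTop ℤ) : WithBot (WithTop ℤ)) ∧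
        ∃ (P : DingDim.Cplx R) (π : P ⟶ X), DingDim.IsDGProjectiveResolution π ∧
          DingDim.IsDingProjective (DingDim.coker P n),
      DingDim.supH X ≤ ((n : WithTop ℤ) : WithBot (WithTop ℤ)) ∧
        ∀ (P : DingDim.Cplx R) (π : P ⟶ X), DingDim.IsDGProjectiveResolution π →
          DingDim.IsDingProjective (DingDim.coker P n),
      ∀ (P : DingDim.Cplx R) (π : P ⟶ X), DingDim.IsDGProjectiveResolution π →
        ∃ (T : DingDim.Cplx R) (τ : T ⟶ P), DingDim.IsSurjectiveFCompleteResolution τ π ∧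
          ∀ i, n ≤ i → ∃ h : T.X i = P.X i, τ.f i = eqToHom h] := by
  tfae_have 1 → 4 := by
    intro h P' π' hπ'
    obtain ⟨T, P, τ, π, hτ, hb⟩ := (DingDim.dpd_le_iff X n).1 h
    obtain ⟨T₁, τ₁, hT₁, hs₁, hb₁⟩ :=
      hτ.resolution.exists_totallyFAcyclic hπ' hτ.totallyFAcyclic n hb
    obtain ⟨T₂, τ₂, hT₂, hs₂, he⟩ := hT₁.exists_eqToHom τ₁ hs₁ n hb₁
    exact ⟨T₂, τ₂, ⟨⟨hπ', hT₂, n, fun i hi => DingDim.bijective_eqToHom (he i hi)⟩, hs₂⟩, he⟩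
  tfae_have 4 → 3 := by
    intro h
    refine ⟨?_, fun P π hπ => ?_⟩
    · obtain ⟨P, π, hπ⟩ := DingDim.exists_isDGProjectiveResolution X
      obtain ⟨T, τ, hτ, he⟩ := h P π hπ
      refine (DingDim.supH_le_iff X n).2 fun k hk =>
        (DingDim.exactElt_iff_of_quasiIso π hπ.quasiIso k).1 ?_
      exact DingDim.exactElt_of_bijective τ hτ.totallyFAcyclic.exact n
        (fun i hi => DingDim.bijective_eqToHom (he i hi)) k hk
    · obtain ⟨T, τ, hτ, he⟩ := h P π hπ
      obtain ⟨e⟩ := DingDim.nonempty_coker_iso τ n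
        fun i hi => DingDim.bijective_eqToHom (he i hi)
      exact hτ.totallyFAcyclic.isDingProjective_of_iso n e
  tfae_have 3 → 2 := by
    rintro ⟨h, H⟩
    obtain ⟨P, π, hπ⟩ := DingDim.exists_isDGProjectiveResolution X
    exact ⟨h, P, π, hπ, H P π hπ⟩
  tfae_have 2 → 1 := by
    rintro ⟨h, P, π, hπ, hP⟩
    obtain ⟨m, rfl⟩ : ∃ m, n = m + 1 := ⟨n - 1, by omega⟩
    obtain ⟨T, hT, ⟨θ⟩⟩ := hP.exists_coker_iso (m + 1)
    obtain ⟨T', τ, hT', -, hb⟩ := hT.exists_of_coker_iso hπ.dgProjective.projective m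
      (fun k hk => (DingDim.exactElt_iff_of_quasiIso π hπ.quasiIso k).2
        ((DingDim.supH_le_iff X _).1 h k hk)) θ
    exact (DingDim.dpd_le_iff X _).2 ⟨T', P, τ, π, ⟨hπ, hT', m + 1, hb⟩, hb⟩
  tfae_finish
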